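/- Let $n\ge 1$. The candidates are $C_1,\dots,C_n$. A qualification ordering is a permutation $\sigma=(\sigma_1,\dots,\sigma_n)$ of the candidates, with $\sigma_1$ the best and $\sigma_n$ the worst; a time ordering is a permutation $\tau=(\tau_1,\dots,\tau_n)$ of the candidates, with $\tau_t$ the candidate that appears at time $t$. Let $t_n$ be the smallest positive integer $t$ with $\frac1t+\frac1{t+1}+\dots+\frac1{n-1}\le 1$. The optimal secretary algorithm stops at the first time $k\ge t_n$ at which $\tau_k$ is the best of $\tau_1,\dots,\tau_k$ with respect to $\sigma$, and at time $n$ if there is no such $k$; the blind choice stops at time $1$. The $p$-mix $M$ tosses a coin that shows heads with probability $p$, and plays the optimal secretary algorithm on heads and the blind choice on tails. An algorithm that stops at time $t$ selects $\tau_t$; let $CM(\sigma,\tau)$ be the candidate selected by $M$. All probabilities are over $\tau$ uniformly distributed on the time orderings and over the independent coin. For $1\le l\le n-1$ let $d_l(\sigma,\rho)$ be the least number of successive swaps, each of two candidates at most $l$ positions apart in the current ordering, that lead from $\rho$ to $\sigma$. The algorithm $M$ is $(\varepsilon,\delta)$-differentially private with respect to $d_l$ if $\mathbb P[CM(\sigma,\tau)\in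 S]\le e^{\varepsilon}\,\mathbb P[CM(\rho,\tau)\in S]+\delta$ for all sets $S$ of candidates and all $\sigma,\rho$ with $d_l(\sigma,\rho)\le 1$. Let $q_{k,n}=\mathbb P[CM(\sigma,\tau)=\sigma_k]$ and $a_k=\sum_{s\ge k}\frac1s\left(1-\frac1e\right)^s$. **Theorem 4.** Let $l\ge1$ be a constant, $p\in(0,1]$ and $\delta\in[0,1]$. For all $n\ge 7$ with $l\le n-1$ and every qualification ordering $\sigma$ (with $q_{k,n}$ computed for $\sigma$) the following hold with respect to $d_l$. 1. If $\delta<q_{1,n}-q_{l+1,n}$, then for every real $\varepsilon$ the $p$-mix $M$ is $(\varepsilon,\delta)$-differentially private if and only if $\varepsilon\ge\ln\frac{q_{1,n}-\delta}{q_{l+1,n}}$. 2. If $\delta\ge q_{1,n}-q_{l+1,n}$, then $M$ is $(\varepsilon,\delta)$-differentially private for every $\varepsilon\ge0$. In particular the bounds are tight: the least $\varepsilon\ge0$ for which $M$ is $(\varepsilon,\delta)$-differentially private is $\ln\frac{q_{1,n}-\delta}{q_{l+1,n}}$ in the first case and $0$ in the second. Moreover, if $\delta<p/e$, then $$\ln\frac{q_{1,n}-\delta}{q_{l+1,n}}\longrightarrow\ln\frac{p-\delta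 e}{a_{l+1}\,p}\qquad(n\to\infty),$$ and if in addition $\delta\ne\frac pe(1-a_{l+1})$ (so that the limit is not $0$), the quotient of the two sides tends to $1$. -/

import Mathlib

open scoped NNReal

noncomputable section

namespace Secretary

/- The `n` candidates are the elements of `Fin n`.  Positions, ranks and times are
zero-based when they are elements of `Fin n`.
A qualification ordering is a permutation `σ`, where `σ i` is the candidate in position `i` and
position `0` is the best one.  A time ordering is a permutation `τ`, where `τ t` is the
candidate that appears at time `t`. -/

/-- The rank (`1` is the best, `n` is the worst) of the candidate `c` in the ordering `σ`. -/
def rank {n : ℕ} (σ : Equiv.Perm (Fin n)) (c : Fin n) : ℕ := (σ.symm c : ℕ) + 1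

/-- A (possibly randomized) selection algorithm: for a qualification ordering and a time ordering
it gives the law of the time at which it stops. -/
abbrev Algorithm (n : ℕ) : Type :=
  Equiv.Perm (Fin n) → Equiv.Perm (Fin n) → PMF (Fin n)

/-- A deterministic rule `M(σ, τ)` as an algorithm. -/
def deterministic {n : ℕ} (M : Equiv.Perm (Fin n) → Equiv.Perm (Fin n) → Fin n) :
    Algorithm n := fun σ τ => PMF.pure (M σ τ)

/-- The law of the selected candidate `τ_{M(σ, τ)}`, for `τ` uniformly distributed. -/
def selectedLaw {n : ℕ} (A : Algorithm n) (σ : Equiv.Perm (Fin n)) : PMF (Fin n) :=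
  (PMF.uniformOfFintype (Equiv.Perm (Fin n))).bind fun τ => (A σ τ).map fun t => τ t

/-- The probability that the selected candidate belongs to `S`. -/
def selectProb {n : ℕ} (A : Algorithm n) (σ : Equiv.Perm (Fin n)) (S : Set (Fin n)) : ℝ :=
  ((selectedLaw A σ).toOuterMeasure S).toReal

/-- The probability that the selected candidate is the `k`-th best one, `1 ≤ k ≤ n`. -/
def rankProb {n : ℕ} (A : Algorithm n) (σ : Equiv.Perm (Fin n)) (k : ℕ) : ℝ :=
  selectProb A σ {c | rank σ c = k}

/-- The threshold: the smallest positive integer `t` with `1/t + 1/(t+1) + ⋯ + 1/(n-1) ≤ 1`. -/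
def threshold (n : ℕ) : ℕ :=
  sInf {t : ℕ | 1 ≤ t ∧ ∑ i ∈ Finset.Ico t n, (1 : ℝ) / (i : ℝ) ≤ 1}

open Classical in
/-- The times (zero-based, so that the time `k` is the `(k+1)`-st step) not before the threshold
at which the current candidate is the best one seen so far. -/
def stopTimes {n : ℕ} (σ τ : Equiv.Perm (Fin n)) : Finset (Fin n) :=
  Finset.univ.filter fun k =>
    threshold n ≤ (k : ℕ) + 1 ∧ ∀ j : Fin n, j ≤ k → rank σ (τ k) ≤ rank σ (τ j)

/-- The stopping time of the optimal secretary algorithm: the first time not before the threshold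
at which the current candidate is the best one seen so far, and the last time if there is none. -/
def optimalTime {n : ℕ} [NeZero n] (σ τ : Equiv.Perm (Fin n)) : Fin n :=
  if h : (stopTimes σ τ).Nonempty then (stopTimes σ τ).min' h
  else ⟨n - 1, Nat.sub_lt (NeZero.pos n) Nat.one_pos⟩

/-- The optimal algorithm for the secretary problem. -/
def optimal (n : ℕ) [NeZero n] : Algorithm n := deterministic optimalTime

/-- The blind choice: always stop at the first candidate. -/
def blindChoice (n : ℕ) [NeZero n] : Algorithm n := deterministic fun _ _ => 0

/-- A coin that shows heads (`true`) with probability `p`. -/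
def coin (p : ℝ≥0) (hp : p ≤ 1) : PMF Bool :=
  PMF.ofFintype (fun b => if b then (p : ENNReal) else 1 - (p : ENNReal)) (by simp [hp])

/-- The `p`-mix of two algorithms: play `A` if the coin shows heads and `B` otherwise. -/
def mix {n : ℕ} (p : ℝ≥0) (hp : p ≤ 1) (A B : Algorithm n) : Algorithm n :=
  fun σ τ => (coin p hp).bind fun b => if b then A σ τ else B σ τ

/-- The `p`-mix of the optimal secretary algorithm and the blind choice. -/
def secretaryMix (n : ℕ) [NeZero n] (p : ℝ≥0) (hp : p ≤ 1) : Algorithm n :=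
  mix p hp (optimal n) (blindChoice n)

/-- `q_{k,n}`: the probability that the `p`-mix of the optimal secretary algorithm and the blind
choice selects the `k`-th best candidate with respect to `σ`. -/
def mixProb {n : ℕ} [NeZero n] (p : ℝ≥0) (hp : p ≤ 1) (σ : Equiv.Perm (Fin n)) (k : ℕ) : ℝ :=
  rankProb (secretaryMix n p hp) σ k

/-- `σ` arises from `ρ` by one transposition of two candidates that are at most `l` positions
apart in `ρ`. -/
def SwapStep {n : ℕ} (l : ℕ) (ρ σ : Equiv.Perm (Fin n)) : Prop :=
  ∃ i j : Fin n, i < j ∧ (j : ℕ) ≤ (i : ℕ) + l ∧ σ = Equiv.swap (ρ i) (ρ j) * ρ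

/-- The `l`-distance of `σ` and `ρ`: the least number `k` of successive such transpositions that
lead from `ρ` to `σ`.  (For `1 ≤ l` such a number exists; the value would be `⊤` otherwise.) -/
def ldist {n : ℕ} (l : ℕ) (σ ρ : Equiv.Perm (Fin n)) : ℕ∞ :=
  sInf {d : ℕ∞ | ∃ k : ℕ, d = (k : ℕ∞) ∧ ∃ π : ℕ → Equiv.Perm (Fin n),
    π 0 = ρ ∧ π k = σ ∧ ∀ i < k, SwapStep l (π i) (π (i + 1))}

/-- `(ε, δ)`-differential privacy with respect to a distance `d` on qualification orderings. -/
def IsDP {n : ℕ} (d : Equiv.Perm (Fin n) → Equiv.Perm (Fin n) → ℕ∞) (A : Algorithm n)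
    (ε δ : ℝ) : Prop :=
  ∀ σ ρ : Equiv.Perm (Fin n), d σ ρ ≤ 1 → ∀ S : Set (Fin n),
    selectProb A σ S ≤ Real.exp ε * selectProb A ρ S + δ

/-- `a_k = ∑_{s ≥ k} (1/s) (1 - 1/e)^s` (the sum runs over `s = k + i`, `i ≥ 0`). -/
def tailSum (k : ℕ) : ℝ :=
  ∑' i : ℕ, 1 / ((k + i : ℕ) : ℝ) * (1 - 1 / Real.exp 1) ^ (k + i)

end Secretary

end

/-! Read a time ordering as the map `θ` from zero-based ranks to arrival times, and let the sample
be the first `m = t_n - 1` times. If the best sampled rank is `k > 0`, the algorithm takes the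
earliest arrival among the `k` better ranks, each equally likely. If it is `0`, the algorithm falls
through to the last time, where every other rank is equally likely. Hence rank `r` is selected with
probability `A * F r + c`, where `F r = [r ≠ 0] + ∑_{j ≥ r} w j`, `F` is `scaledProb`, `w` is
`weight`, and `A > 0` and `c ≥ 0` do not depend on `r` (`card_chosenRank`, `mixValue`).

Neighbouring orderings exchange two ranks `i < j ≤ i + l`, so privacy reduces to `q i ≤ e^ε * q j +
δ`. Since `q` is decreasing, `j = i + l` is the worst case. If `q` is also log-convex, then `q i * q
l ≤ q 0 * q (i + l)`, and the pair `(0, l)` is the worst of all (`le_mul_add_of_logConvex`). That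
pair is realised by an actual swap (`mixValue_le_of_isDP`), which gives tightness.

The crux is log-convexity of `F`, which for `r ≥ 1` amounts to `w r * w (r + 1) ≤ F (r + 1) * (w r -
w (r + 1))`. This is proved by downward induction on `r` (`weight_mul_le_scaledProb_mul`). Where `w`
is locally log-convex the inequality propagates; elsewhere the weights are so small that the summand
`1` in `F` suffices (`weight_sq_le_sub`). The step at `r = 0` is separate, because `F 0` lacks that
`1`.

For the limit, comparing harmonic sums with logarithms gives `m / n → 1 / e`, and dominated
convergence turns the sums of weights into `a_k / e`. -/

noncomputable section
namespace Secretary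

open Finset

/-! ### Counting time orderings

A permutation `θ` is read as the map that sends a (zero-based) rank to the time at which the
candidate of that rank appears.  The sample consists of the times below `m`. -/

/-- Double counting for a family of predicates that is symmetric under transpositions. -/
lemma card_mul_card_filter_of_swap {n : ℕ} (S : Finset (Fin n))
    (P : Fin n → Equiv.Perm (Fin n) → Prop) (X : Equiv.Perm (Fin n) → Prop)
    [∀ a, DecidablePred (P a)] [DecidablePred X] (c : ℕ)
    (hswap : ∀ a ∈ S, ∀ b ∈ S, ∀ θ, P a θ → P b (θ * Equiv.swap a b))
    (hX : ∀ a ∈ S, ∀ θ, P a θ → X θ)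
    (hc : ∀ θ, X θ → #{a ∈ S | P a θ} = c) {a : Fin n} (ha : a ∈ S) :
    #S * #{θ | P a θ} = c * #{θ | X θ} := by
  have h1 : ∀ b ∈ S, #{θ | P b θ} = #{θ | P a θ} := by
    intro b hb
    refine Finset.card_equiv (Equiv.mulRight (Equiv.swap a b)) fun θ => ?_
    simp only [mem_filter, mem_univ, true_and, Equiv.coe_mulRight]
    refine ⟨fun h => ?_, fun h => ?_⟩
    · simpa [Equiv.swap_comm] using hswap b hb a ha θ h
    · simpa [mul_assoc] using hswap a ha b hb _ h
  have h2 : ∑ b ∈ S, #{θ | P b θ} = ∑ θ, #{b ∈ S | P b θ} :=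
    Finset.sum_card_bipartiteAbove_eq_sum_card_bipartiteBelow (s := S) (t := univ)
      (fun b θ => P b θ)
  rw [Finset.sum_congr rfl h1, sum_const, smul_eq_mul] at h2
  rw [h2, mul_comm, card_filter, Finset.sum_mul]
  refine Finset.sum_congr rfl fun θ _ => ?_
  by_cases h : X θ
  · simp [h, hc θ h]
  · rw [if_neg h, zero_mul, card_eq_zero, filter_eq_empty_iff]
    exact fun b hb hP => h (hX b hb θ hP)

/-- All candidates of rank below `k` appear after the sample. -/
def AllLate {n : ℕ} (m k : ℕ) (θ : Equiv.Perm (Fin n)) : Prop :=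
  ∀ i : Fin n, (i : ℕ) < k → m ≤ θ i

/-- The best candidate of the sample has rank `k`. -/
def SampleBest {n : ℕ} (m : ℕ) (k : Fin n) (θ : Equiv.Perm (Fin n)) : Prop :=
  AllLate m k θ ∧ (θ k : ℕ) < m

open Classical in
/-- The number of orderings for which the best candidate of the sample has rank `k`. -/
def bestCount (n m : ℕ) (k : Fin n) : ℕ := #{θ : Equiv.Perm (Fin n) | SampleBest m k θ}

open Classical in
/-- The number of orderings for which all candidates of rank below `k` come after the sample. -/
def lateCount (n m k : ℕ) : ℕ := #{θ : Equiv.Perm (Fin n) | AllLate m k θ}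

lemma AllLate.mul_swap {n m k : ℕ} {θ : Equiv.Perm (Fin n)} (h : AllLate m k θ) {a b : Fin n}
    (hab : (a : ℕ) < k ↔ (b : ℕ) < k) : AllLate m k (θ * Equiv.swap a b) := by
  intro i hi
  rw [Equiv.Perm.mul_apply]
  apply h
  by_cases h1 : i = a
  · subst h1; rw [Equiv.swap_apply_left]; exact hab.mp hi
  by_cases h2 : i = b
  · subst h2; rw [Equiv.swap_apply_right]; exact hab.mpr hi
  rwa [Equiv.swap_apply_of_ne_of_ne h1 h2]

lemma card_filter_perm_lt {n m : ℕ} (hm : m ≤ n) (θ : Equiv.Perm (Fin n)) :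
    #{j : Fin n | (θ j : ℕ) < m} = m := by
  have : #{j : Fin n | (θ j : ℕ) < m} = #{j : Fin n | (j : ℕ) < m} :=
    Finset.card_equiv θ fun j => by simp
  rw [this, Fin.card_filter_val_lt]; omega

/-- When the ranks below `k` all come late, the `m` sample times are filled by the other `n - k`
ranks, which are interchangeable. -/
lemma sub_mul_bestCount {n m : ℕ} (hm : m ≤ n) (k : Fin n) :
    (n - k) * bestCount n m k = m * lateCount n m k := by
  classical
  have := card_mul_card_filter_of_swap (Finset.Ici k) (fun j θ => AllLate m k θ ∧ (θ j : ℕ) < m)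
    (AllLate m k) m ?_ (fun _ _ _ h => h.1) ?_ (Finset.mem_Ici.mpr le_rfl)
  · rw [Fin.card_Ici] at this
    unfold bestCount lateCount SampleBest
    convert this
  · rintro a ha b hb θ ⟨h1, h2⟩
    rw [Finset.mem_Ici, Fin.le_def] at ha hb
    exact ⟨h1.mul_swap (by omega), by simpa using h2⟩
  · intro θ h
    refine Eq.trans (congrArg Finset.card ?_) (card_filter_perm_lt hm θ)
    ext j
    simp only [mem_filter, Finset.mem_Ici, mem_univ, true_and, h, Fin.le_def]
    exact ⟨fun h => h.2, fun h' => ⟨by by_contra hj; have := h j (by omega); omega, h'⟩⟩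

lemma lateCount_succ_add {n m : ℕ} (k : Fin n) :
    lateCount n m (k + 1) + bestCount n m k = lateCount n m k := by
  classical
  unfold lateCount bestCount
  rw [← Finset.card_union_of_disjoint]
  · congr 1
    ext θ
    rw [mem_union, mem_filter_univ, mem_filter_univ, mem_filter_univ]
    constructor
    · rintro (h | h)
      · exact fun i hi => h i (by omega)
      · exact h.1
    · intro h
      by_cases h2 : (θ k : ℕ) < m
      · exact Or.inr ⟨h, h2⟩
      · refine Or.inl fun i hi => ?_
        rcases Nat.lt_succ_iff_lt_or_eq.mp hi with h3 | h3
        · exact h i h3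
        · rw [Fin.ext h3]; omega
  · rw [Finset.disjoint_filter]
    rintro θ - h1 h2
    have := h1 k (by omega)
    exact absurd h2.2 (by omega)

lemma lateCount_zero (n m : ℕ) : lateCount n m 0 = n.factorial := by
  classical
  simp [lateCount, AllLate, Fintype.card_perm]

/-- Eliminating `lateCount` from the two preceding relations leaves a recursion whose solution is a
product. -/
lemma natCast_bestCount_succ {n m : ℕ} (hm : m ≤ n) (k : ℕ) (hk : k + 1 < n) :
    ((n : ℝ) - 1 - k) * bestCount n m ⟨k + 1, hk⟩ =
      ((n : ℝ) - m - k) * bestCount n m ⟨k, by omega⟩ := by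
  have h1 := congrArg (Nat.cast : ℕ → ℝ) (sub_mul_bestCount hm ⟨k + 1, hk⟩)
  have h2 := congrArg (Nat.cast : ℕ → ℝ) (sub_mul_bestCount hm ⟨k, by omega⟩)
  have h3 := congrArg (Nat.cast : ℕ → ℝ) (lateCount_succ_add (m := m) (⟨k, by omega⟩ : Fin n))
  push_cast [Nat.cast_sub (show k ≤ n by omega), Nat.cast_sub (show k + 1 ≤ n by omega)]
    at h1 h2 h3
  linear_combination h1 - h2 + (m : ℝ) * h3

/-- The weights from which the selection probabilities are built. -/
def weight (n m j : ℕ) : ℝ :=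
  ((n : ℝ) - m) / (j + 1) * ∏ i ∈ range j, ((n : ℝ) - m - 1 - i) / ((n : ℝ) - 2 - i)

lemma natCast_bestCount_zero {n m : ℕ} (hm : m ≤ n) (hn : 0 < n) :
    (bestCount n m ⟨0, hn⟩ : ℝ) = n.factorial * (m / n) := by
  have h1 := congrArg (Nat.cast : ℕ → ℝ) (sub_mul_bestCount hm ⟨0, hn⟩)
  have : (n : ℝ) ≠ 0 := by positivity
  push_cast [lateCount_zero, Nat.sub_zero] at h1
  field_simp
  linear_combination h1

/-- The factor `k + 1` is split off because that many better ranks share this case equally; `weight`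
is the share of each. -/
lemma natCast_bestCount_eq_weight {n m : ℕ} (hm : m ≤ n) (k : ℕ) (hk : k + 1 < n) :
    (bestCount n m ⟨k + 1, hk⟩ : ℝ) =
      n.factorial * (m / (n * (n - 1))) * ((k + 1) * weight n m k) := by
  have hn : (n : ℝ) ≠ 0 := by norm_cast; omega
  have hn1 : (n : ℝ) - 1 ≠ 0 := by
    have : (1 : ℝ) < n := by norm_cast; omega
    linarith
  induction k with
  | zero =>
    have h := natCast_bestCount_succ hm 0 hk
    have h0 := natCast_bestCount_zero hm (show 0 < n by omega)
    rw [h0] at h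
    simp only [Nat.cast_zero, sub_zero, zero_add] at h
    simp only [weight, range_zero, prod_empty]
    field_simp at h ⊢
    linear_combination h
  | succ k ih =>
    have h := natCast_bestCount_succ hm (k + 1) hk
    rw [ih (by omega)] at h
    have h2 : (n : ℝ) - 1 - (k + 1 : ℕ) ≠ 0 := by
      have : ((k + 1 : ℕ) : ℝ) + 1 < n := by exact_mod_cast hk
      push_cast at this ⊢; linarith
    have h3 : (n : ℝ) - 2 - k ≠ 0 := by push_cast at h2; intro h'; apply h2; linarith
    apply mul_left_cancel₀ h2
    rw [h, weight, weight, prod_range_succ]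
    have h4 : (k : ℝ) + 1 ≠ 0 := by positivity
    have h5 : (k : ℝ) + 1 + 1 ≠ 0 := by positivity
    generalize (∏ i ∈ range k, ((n : ℝ) - m - 1 - i) / ((n : ℝ) - 2 - i)) = Q
    push_cast
    field_simp
    ring

end Secretary
end

noncomputable section
namespace Secretary

open Finset

/-! ### The stopping time in terms of the arrival times of the ranks -/

lemma inv_apply_apply {n : ℕ} (θ : Equiv.Perm (Fin n)) (i : Fin n) : θ⁻¹ (θ i) = i :=
  θ.symm_apply_apply i

lemma apply_inv_apply {n : ℕ} (θ : Equiv.Perm (Fin n)) (i : Fin n) : θ (θ⁻¹ i) = i :=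
  θ.apply_symm_apply i

lemma optimalTime_eq_one_left {n : ℕ} [NeZero n] (σ τ : Equiv.Perm (Fin n)) :
    optimalTime σ τ = optimalTime 1 (σ⁻¹ * τ) := rfl

lemma mem_stopTimes_one {n m : ℕ} (hm : threshold n = m + 1) (π : Equiv.Perm (Fin n))
    (k : Fin n) : k ∈ stopTimes 1 π ↔ m ≤ k ∧ ∀ j ≤ k, π k ≤ π j := by
  simp [stopTimes, hm, rank, show ∀ i, Equiv.symm (1 : Equiv.Perm (Fin n)) i = i from fun _ => rfl]

/-- The rank `r` is the first one to appear among the ranks below `k`. -/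
def FirstBelow {n : ℕ} (k r : Fin n) (θ : Equiv.Perm (Fin n)) : Prop :=
  ∀ i < k, θ r ≤ θ i

/-- The zero-based rank of the candidate chosen by the optimal algorithm. -/
def chosenRank {n : ℕ} [NeZero n] (θ : Equiv.Perm (Fin n)) : Fin n :=
  θ⁻¹ (optimalTime 1 θ⁻¹)

/-- A record after the sample must beat the sample's best rank `k`, and the first arrival among the
ranks below `k` is such a record. -/
lemma SampleBest.chosenRank_eq {n m : ℕ} [NeZero n] (hm : threshold n = m + 1)
    {θ : Equiv.Perm (Fin n)} {k r : Fin n} (hk : SampleBest m k θ) (hr : r < k)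
    (hfirst : FirstBelow k r θ) : chosenRank θ = r := by
  have hmem : θ r ∈ stopTimes 1 θ⁻¹ := by
    rw [mem_stopTimes_one hm]
    refine ⟨hk.1 r hr, fun j hj => ?_⟩
    rw [inv_apply_apply]
    by_contra! h
    have h2 := hfirst _ (h.trans hr)
    rw [apply_inv_apply] at h2
    have h3 : j = θ r := le_antisymm hj h2
    rw [h3, inv_apply_apply] at h
    exact lt_irrefl _ h
  have hle : ∀ j ∈ stopTimes 1 θ⁻¹, θ r ≤ j := by
    intro j hj
    rw [mem_stopTimes_one hm] at hj
    have h1 := hj.2 (θ k) (by rw [Fin.le_def]; have := hk.2; omega)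
    rw [inv_apply_apply] at h1
    have h2 : θ⁻¹ j ≠ k := by
      rintro rfl
      have := hk.2
      rw [apply_inv_apply] at this
      omega
    have h3 := hfirst _ (lt_of_le_of_ne h1 h2)
    rwa [apply_inv_apply] at h3
  have h : optimalTime 1 θ⁻¹ = θ r := by
    rw [optimalTime, dif_pos ⟨_, hmem⟩]
    exact le_antisymm (Finset.min'_le _ _ hmem) (hle _ (Finset.min'_mem _ _))
  rw [chosenRank, h, inv_apply_apply]

lemma SampleBest.optimalTime_eq {n m : ℕ} [NeZero n] (hm : threshold n = m + 1)
    {θ : Equiv.Perm (Fin n)} (hk : SampleBest m 0 θ) :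
    optimalTime 1 θ⁻¹ = ⟨n - 1, Nat.sub_lt (NeZero.pos n) Nat.one_pos⟩ := by
  rw [optimalTime, dif_neg]
  rintro ⟨j, hj⟩
  rw [mem_stopTimes_one hm] at hj
  have h2 := hk.2
  have h1 := hj.2 (θ 0) (by rw [Fin.le_def]; omega)
  rw [inv_apply_apply] at h1
  replace h1 : θ⁻¹ j = 0 := le_antisymm h1 (Fin.zero_le _)
  rw [← h1, apply_inv_apply] at h2
  omega

lemma exists_firstBelow {n : ℕ} {k : Fin n} (θ : Equiv.Perm (Fin n)) (hk : 0 < (k : ℕ)) :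
    ∃ r < k, FirstBelow k r θ := by
  obtain ⟨r, hr, h⟩ := Finset.exists_min_image (Finset.Iio k) θ ⟨⟨0, by omega⟩, by
    rw [Finset.mem_Iio, Fin.lt_def]; exact hk⟩
  exact ⟨r, Finset.mem_Iio.mp hr, fun i hi => h i (Finset.mem_Iio.mpr hi)⟩

lemma FirstBelow.eq {n : ℕ} {k r s : Fin n} {θ : Equiv.Perm (Fin n)} (hr : FirstBelow k r θ)
    (hs : FirstBelow k s θ) (hrk : r < k) (hsk : s < k) : r = s :=
  θ.injective (le_antisymm (hr s hsk) (hs r hrk))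

lemma SampleBest.chosenRank_eq_iff {n m : ℕ} [NeZero n] (hm : threshold n = m + 1)
    {θ : Equiv.Perm (Fin n)} {k : Fin n} (hk : SampleBest m k θ) (h0 : 0 < (k : ℕ)) (r : Fin n) :
    chosenRank θ = r ↔ r < k ∧ FirstBelow k r θ := by
  obtain ⟨s, hs, hfirst⟩ := exists_firstBelow θ h0
  rw [hk.chosenRank_eq hm hs hfirst]
  constructor
  · rintro rfl; exact ⟨hs, hfirst⟩
  · rintro ⟨h1, h2⟩; exact hfirst.eq h2 hs h1

lemma exists_sampleBest {n m : ℕ} (hm0 : 0 < m) (hmn : m ≤ n) (θ : Equiv.Perm (Fin n)) :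
    ∃ k, SampleBest m k θ := by
  obtain ⟨k, hk, h⟩ := Finset.exists_min_image ({j : Fin n | (θ j : ℕ) < m} : Finset (Fin n)) id
    (by rw [← Finset.card_pos, card_filter_perm_lt hmn]; exact hm0)
  simp only [mem_filter, mem_univ, true_and, id] at hk h
  refine ⟨k, fun i hi => ?_, hk⟩
  by_contra! h'
  exact absurd (h i h') (not_le.mpr hi)

lemma SampleBest.eq {n m : ℕ} {k k' : Fin n} {θ : Equiv.Perm (Fin n)} (h : SampleBest m k θ)
    (h' : SampleBest m k' θ) : k = k' := by
  rcases lt_trichotomy k k' with hlt | rfl | hlt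
  · exact absurd h.2 (not_lt.mpr (h'.1 k hlt))
  · rfl
  · exact absurd h'.2 (not_lt.mpr (h.1 k' hlt))

open Classical in
lemma mul_card_sampleBest_firstBelow {n m : ℕ} {k r : Fin n} (hr : r < k) :
    (k : ℕ) * #{θ : Equiv.Perm (Fin n) | SampleBest m k θ ∧ FirstBelow k r θ} =
      bestCount n m k := by
  have := card_mul_card_filter_of_swap (Finset.Iio k)
    (fun r θ => SampleBest m k θ ∧ FirstBelow k r θ) (SampleBest m k) 1 ?_ (fun _ _ _ h => h.1) ?_
    (Finset.mem_Iio.mpr hr)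
  · rw [Fin.card_Iio, one_mul] at this
    exact this
  · rintro a ha b hb θ ⟨⟨h1, h2⟩, h3⟩
    rw [Finset.mem_Iio] at ha hb
    refine ⟨⟨h1.mul_swap ⟨fun _ => hb, fun _ => ha⟩, ?_⟩, fun i hi => ?_⟩
    · rwa [Equiv.Perm.mul_apply, Equiv.swap_apply_of_ne_of_ne ha.ne' hb.ne']
    · rw [Equiv.Perm.mul_apply, Equiv.Perm.mul_apply, Equiv.swap_apply_right]
      apply h3
      by_cases h1 : i = a
      · subst h1; rwa [Equiv.swap_apply_left]
      by_cases h2 : i = b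
      · subst h2; rwa [Equiv.swap_apply_right]
      rwa [Equiv.swap_apply_of_ne_of_ne h1 h2]
  · intro θ h
    rw [Finset.card_eq_one]
    obtain ⟨s, hs, hfirst⟩ := exists_firstBelow θ (k := k) (by rw [Fin.lt_def] at hr; omega)
    refine ⟨s, ?_⟩
    ext i
    simp only [mem_filter, Finset.mem_Iio, mem_singleton]
    constructor
    · rintro ⟨h1, -, h2⟩; exact h2.eq hfirst h1 hs
    · rintro rfl; exact ⟨hs, h, hfirst⟩

open Classical in
lemma mul_card_sampleBest_zero_last {n m : ℕ} [NeZero n] (hmn : m < n) {r : Fin n} (hr : r ≠ 0) :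
    (n - 1) * #{θ : Equiv.Perm (Fin n) | SampleBest m 0 θ ∧ (θ r : ℕ) = n - 1} =
      bestCount n m 0 := by
  have := card_mul_card_filter_of_swap ({0}ᶜ : Finset (Fin n))
    (fun r θ => SampleBest m 0 θ ∧ (θ r : ℕ) = n - 1) (SampleBest m 0) 1 ?_ (fun _ _ _ h => h.1) ?_
    (a := r) (by simpa using hr)
  · rw [Finset.card_compl, Fintype.card_fin, card_singleton, one_mul] at this
    exact this
  · rintro a ha b hb θ ⟨⟨h1, h2⟩, h3⟩
    simp only [mem_compl, mem_singleton] at ha hb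
    refine ⟨⟨fun i hi => absurd hi (by simp), ?_⟩, by simpa using h3⟩
    rwa [Equiv.Perm.mul_apply, Equiv.swap_apply_of_ne_of_ne (Ne.symm ha) (Ne.symm hb)]
  · intro θ h
    rw [Finset.card_eq_one]
    -- The rank at the last time is not `0`: rank `0` lies in the sample, which ends before time `n
    -- - 1` because `m < n`.
    refine ⟨θ⁻¹ ⟨n - 1, by omega⟩, ?_⟩
    ext i
    simp only [mem_filter, mem_compl, mem_singleton, Equiv.Perm.eq_inv_iff_eq, Fin.ext_iff,
      h, true_and]
    refine ⟨fun h' => h'.2, fun h' => ⟨fun h0 => ?_, h'⟩⟩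
    have h2 := h.2
    rw [← (Fin.ext h0 : i = 0)] at h2
    omega

open Classical in
lemma card_chosenRank_eq_sum {n m : ℕ} [NeZero n] (hm0 : 0 < m) (hmn : m ≤ n) (r : Fin n) :
    #{θ : Equiv.Perm (Fin n) | chosenRank θ = r} =
      ∑ k, #{θ : Equiv.Perm (Fin n) | SampleBest m k θ ∧ chosenRank θ = r} := by
  rw [← Finset.card_biUnion]
  · congr 1
    ext θ
    simp only [mem_filter, mem_univ, true_and, mem_biUnion]
    refine ⟨fun h => ?_, fun ⟨k, hk⟩ => hk.2⟩
    obtain ⟨k, hk⟩ := exists_sampleBest hm0 hmn θ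
    exact ⟨k, hk, h⟩
  · intro k _ k' _ hne
    rw [Function.onFun, Finset.disjoint_filter]
    exact fun θ _ h h' => hne (h.1.eq h'.1)

/-- The (scaled) probability that the optimal algorithm selects the zero-based rank `r`. -/
def scaledProb (n m r : ℕ) : ℝ :=
  (if r = 0 then 0 else 1) + ∑ j ∈ Finset.Ico r (n - 1), weight n m j

open Classical in
-- The cases are split by the best sampled rank. Rank `0` contributes the summand `1` of
-- `scaledProb`, and rank `j + 1` contributes `weight n m j` to each better rank.
lemma card_chosenRank {n m : ℕ} [NeZero n] (hm : threshold n = m + 1) (hm0 : 0 < m)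
    (hmn : m < n) (r : Fin n) :
    (#{θ : Equiv.Perm (Fin n) | chosenRank θ = r} : ℝ) =
      n.factorial * (m / (n * (n - 1))) * scaledProb n m r := by
  have hn : (n : ℝ) ≠ 0 := by norm_cast; omega
  have hn1' : (1 : ℝ) < n := by norm_cast; omega
  have hn1 : (n : ℝ) - 1 ≠ 0 := by linarith
  obtain ⟨N, rfl⟩ : ∃ N, n = N + 1 := ⟨n - 1, by omega⟩
  rw [card_chosenRank_eq_sum hm0 hmn.le, Nat.cast_sum, Fin.sum_univ_succ, scaledProb, mul_add]
  congr 1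
  · have hcount : #{θ : Equiv.Perm (Fin (N + 1)) | SampleBest m 0 θ ∧ chosenRank θ = r} =
        #{θ : Equiv.Perm (Fin (N + 1)) | SampleBest m 0 θ ∧ (θ r : ℕ) = N + 1 - 1} := by
      congr 1
      ext θ
      simp only [mem_filter, mem_univ, true_and]
      refine and_congr_right fun h => ?_
      rw [chosenRank, h.optimalTime_eq hm, Equiv.Perm.inv_eq_iff_eq, Fin.ext_iff]
      exact eq_comm
    rw [hcount]
    by_cases hr : r = 0
    · subst hr
      simp only [Fin.val_zero, if_true, mul_zero, Nat.cast_eq_zero, card_eq_zero,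
        filter_eq_empty_iff]
      rintro θ - ⟨⟨-, h1⟩, h2⟩
      omega
    · have h := congrArg (Nat.cast : ℕ → ℝ) (mul_card_sampleBest_zero_last hmn hr)
      have h0 := natCast_bestCount_zero hmn.le (Nat.succ_pos N)
      rw [if_neg (by rwa [Fin.val_eq_zero_iff]), mul_one]
      change (_ : ℝ) = bestCount (N + 1) m ⟨0, _⟩ at h
      rw [h0, Nat.cast_mul, Nat.cast_sub (by omega), Nat.cast_one] at h
      apply mul_left_cancel₀ hn1
      rw [h]
      field_simp
  · have hterm : ∀ k : Fin N,
        (#{θ : Equiv.Perm (Fin (N + 1)) | SampleBest m k.succ θ ∧ chosenRank θ = r} : ℝ) =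
          if (r : ℕ) ≤ k then ((N + 1).factorial *
            (m / ((N + 1 : ℕ) * ((N + 1 : ℕ) - 1))) * weight (N + 1) m k : ℝ) else 0 := by
      intro k
      have hcount : #{θ : Equiv.Perm (Fin (N + 1)) | SampleBest m k.succ θ ∧ chosenRank θ = r} =
          #{θ : Equiv.Perm (Fin (N + 1)) |
            SampleBest m k.succ θ ∧ r < k.succ ∧ FirstBelow k.succ r θ} := by
        congr 1
        ext θ
        simp only [mem_filter, mem_univ, true_and]
        exact and_congr_right fun h => h.chosenRank_eq_iff hm (by simp) r
      rw [hcount]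
      have hlt : r < k.succ ↔ (r : ℕ) ≤ k := by
        rw [Fin.lt_def, Fin.val_succ, Nat.lt_succ_iff]
      by_cases hrk : (r : ℕ) ≤ k
      · have hrk' := hlt.mpr hrk
        have h := congrArg (Nat.cast : ℕ → ℝ) (mul_card_sampleBest_firstBelow (m := m) hrk')
        have h0 := natCast_bestCount_eq_weight hmn.le (k : ℕ) (by omega)
        change (_ : ℝ) = bestCount (N + 1) m ⟨k + 1, _⟩ at h
        rw [h0, Nat.cast_mul, Fin.val_succ] at h
        simp only [hrk', true_and, if_pos hrk]
        have hk : ((k : ℕ) : ℝ) + 1 ≠ 0 := by positivity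
        apply mul_left_cancel₀ hk
        rw [Nat.cast_succ] at h
        rw [h]
        ring
      · simp [hlt, hrk]
    rw [Finset.sum_congr rfl fun k _ => hterm k, Fin.sum_univ_eq_sum_range (fun k =>
      if (r : ℕ) ≤ k then ((N + 1).factorial *
        (m / ((N + 1 : ℕ) * ((N + 1 : ℕ) - 1))) * weight (N + 1) m k : ℝ) else 0) N,
      ← Finset.sum_filter, mul_sum, Nat.add_sub_cancel]
    refine Finset.sum_congr ?_ fun _ _ => rfl
    ext j
    simp [and_comm]

end Secretary
end

noncomputable section
namespace Secretary

open Finset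

/-! ### The law of the selected candidate -/

lemma selectProb_eq_sum {n : ℕ} (A : Algorithm n) (σ : Equiv.Perm (Fin n)) (S : Set (Fin n))
    [DecidablePred (· ∈ S)] :
    selectProb A σ S = ∑ r, if σ r ∈ S then ((selectedLaw A σ) (σ r)).toReal else 0 := by
  rw [selectProb, PMF.toOuterMeasure_apply_fintype, ENNReal.toReal_sum]
  · rw [← Equiv.sum_comp σ]
    refine Finset.sum_congr rfl fun r _ => ?_
    by_cases h : σ r ∈ S <;> simp [h]
  · intro c _
    by_cases h : c ∈ S <;> simp [h, PMF.apply_ne_top]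

lemma selectedLaw_secretaryMix_apply {n : ℕ} [NeZero n] (p : ℝ≥0) (hp : p ≤ 1)
    (σ : Equiv.Perm (Fin n)) (c : Fin n) :
    ((selectedLaw (secretaryMix n p hp) σ) c).toReal =
      p * (#{τ : Equiv.Perm (Fin n) | τ (optimalTime σ τ) = c} / n.factorial) +
        (1 - p) * (#{τ : Equiv.Perm (Fin n) | τ 0 = c} / n.factorial) := by
  have hterm : ∀ τ : Equiv.Perm (Fin n),
      (((secretaryMix n p hp σ τ).map fun t => τ t) c).toReal =
        p * (if τ (optimalTime σ τ) = c then 1 else 0) +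
          (1 - p) * (if τ 0 = c then 1 else 0) := by
    intro τ
    rw [secretaryMix, mix, PMF.map_bind, PMF.bind_apply, tsum_bool]
    simp only [coin, PMF.ofFintype_apply, optimal, blindChoice, deterministic, PMF.pure_map,
      PMF.pure_apply, Bool.false_eq_true, if_false, if_true, eq_comm (a := c)]
    rw [ENNReal.toReal_add, add_comm]
    · congr 1
      · split_ifs <;> simp
      · rw [ENNReal.toReal_mul, ENNReal.toReal_sub_of_le (by exact_mod_cast hp) (by simp)]
        split_ifs <;> simp
    · split_ifs <;> simp
    · split_ifs <;> simp
  rw [selectedLaw, PMF.bind_apply, tsum_fintype, ENNReal.toReal_sum]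
  · simp only [ENNReal.toReal_mul, hterm, PMF.uniformOfFintype_apply, Fintype.card_perm,
      Fintype.card_fin, ENNReal.toReal_inv, ENNReal.toReal_natCast]
    rw [← Finset.mul_sum, Finset.sum_add_distrib, ← Finset.mul_sum, ← Finset.mul_sum,
      Finset.sum_boole, Finset.sum_boole]
    ring
  · exact fun τ _ => ENNReal.mul_ne_top (PMF.apply_ne_top _ _) (PMF.apply_ne_top _ _)

lemma card_perm_apply_zero {n : ℕ} [NeZero n] (c : Fin n) :
    (#{τ : Equiv.Perm (Fin n) | τ 0 = c} / n.factorial : ℝ) = 1 / n := by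
  have h := card_mul_card_filter_of_swap (univ : Finset (Fin n)) (fun a τ => τ a = c)
    (fun _ => True) 1 (fun a _ b _ θ h => by simpa using h) (fun _ _ _ _ => trivial)
    (fun θ _ => by
      rw [Finset.card_eq_one]
      exact ⟨θ⁻¹ c, by ext i; simp [Equiv.eq_symm_apply]⟩) (mem_univ 0)
  have h' := congrArg (Nat.cast : ℕ → ℝ) h
  simp only [card_univ, Fintype.card_fin, one_mul, filter_true, Fintype.card_perm,
    Nat.cast_mul] at h'
  have : (n : ℝ) ≠ 0 := NeZero.ne _
  field_simp
  linear_combination h'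

/-- The substitution `θ = τ⁻¹ * σ` is a bijection of time orderings, so the law of the chosen rank
does not depend on `σ`. -/
lemma card_apply_optimalTime {n : ℕ} [NeZero n] (σ : Equiv.Perm (Fin n)) (r : Fin n) :
    #{τ : Equiv.Perm (Fin n) | τ (optimalTime σ τ) = σ r} =
      #{θ : Equiv.Perm (Fin n) | chosenRank θ = r} := by
  refine Finset.card_equiv ((Equiv.inv _).trans (Equiv.mulRight σ)) fun τ => ?_
  rw [mem_filter_univ, mem_filter_univ]
  simp only [Equiv.trans_apply, Equiv.inv_apply, Equiv.coe_mulRight, chosenRank, mul_inv_rev,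
    inv_inv, Equiv.Perm.mul_apply, optimalTime_eq_one_left σ τ]
  exact (Equiv.symm_apply_eq σ).symm

/-- The probability that the `p`-mix selects the candidate of zero-based rank `r`. -/
def mixValue (p : ℝ) (n m r : ℕ) : ℝ :=
  p * (m / (n * (n - 1)) * scaledProb n m r) + (1 - p) * (1 / n)

lemma selectedLaw_eq_mixValue {n m : ℕ} [NeZero n] (hm : threshold n = m + 1) (hm0 : 0 < m)
    (hmn : m < n) (p : ℝ≥0) (hp : p ≤ 1) (σ : Equiv.Perm (Fin n)) (r : Fin n) :
    ((selectedLaw (secretaryMix n p hp) σ) (σ r)).toReal = mixValue p n m r := by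
  classical
  rw [selectedLaw_secretaryMix_apply, card_perm_apply_zero, card_apply_optimalTime]
  have h := card_chosenRank hm hm0 hmn r
  have hf : (n.factorial : ℝ) ≠ 0 := by exact_mod_cast n.factorial_ne_zero
  rw [mixValue]
  congr 2
  rw [div_eq_iff hf]
  convert h.trans _
  ring

lemma mixProb_eq_mixValue {n m : ℕ} [NeZero n] (hm : threshold n = m + 1) (hm0 : 0 < m)
    (hmn : m < n) (p : ℝ≥0) (hp : p ≤ 1) (σ : Equiv.Perm (Fin n)) {k : ℕ} (hk : k < n) :
    mixProb p hp σ (k + 1) = mixValue p n m k := by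
  classical
  rw [mixProb, rankProb, selectProb_eq_sum, Finset.sum_eq_single ⟨k, hk⟩]
  · rw [if_pos (by simp [rank]), selectedLaw_eq_mixValue hm hm0 hmn]
  · intro r _ hr
    rw [if_neg]
    simpa [rank, Fin.ext_iff] using hr
  · simp

/-! ### Differential privacy for neighbouring orderings -/

lemma swapStep_eq {n l : ℕ} {ρ σ : Equiv.Perm (Fin n)} (h : SwapStep l ρ σ) :
    ∃ i j : Fin n, i < j ∧ (j : ℕ) ≤ i + l ∧ σ = ρ * Equiv.swap i j := by
  obtain ⟨i, j, hij, hl, rfl⟩ := h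
  exact ⟨i, j, hij, hl, by rw [Equiv.mul_swap_eq_swap_mul]⟩

lemma eq_or_swapStep_of_ldist_le_one {n l : ℕ} {σ ρ : Equiv.Perm (Fin n)}
    (h : ldist l σ ρ ≤ 1) : σ = ρ ∨ SwapStep l ρ σ := by
  -- An empty set would have infimum `⊤`; in a nonempty one the infimum is attained.
  have hne : {d : ℕ∞ | ∃ k : ℕ, d = (k : ℕ∞) ∧ ∃ π : ℕ → Equiv.Perm (Fin n),
      π 0 = ρ ∧ π k = σ ∧ ∀ i < k, SwapStep l (π i) (π (i + 1))}.Nonempty := by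
    rw [Set.nonempty_iff_ne_empty]
    intro hempty
    rw [ldist, hempty, sInf_empty] at h
    exact absurd h (by decide)
  obtain ⟨k, hk, π, h0, h1, hstep⟩ := csInf_mem hne
  rw [ldist, hk] at h
  have hk1 : k ≤ 1 := by exact_mod_cast h
  interval_cases k
  · exact Or.inl (h1.symm.trans h0)
  · right
    have := hstep 0 one_pos
    rwa [h0, h1] at this

lemma ldist_le_one {n l : ℕ} {σ ρ : Equiv.Perm (Fin n)} (h : SwapStep l ρ σ) :
    ldist l σ ρ ≤ 1 := by
  refine sInf_le ⟨1, rfl, fun i => if i = 0 then ρ else σ, by simp, by simp, fun i hi => ?_⟩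
  obtain rfl : i = 0 := by omega
  simpa using h

lemma isDP_of_mixValue {n m : ℕ} [NeZero n] (hm : threshold n = m + 1) (hm0 : 0 < m)
    (hmn : m < n) (p : ℝ≥0) (hp : p ≤ 1) {l : ℕ} {ε δ : ℝ} (hε : 0 ≤ ε) (hδ : 0 ≤ δ)
    (hnonneg : ∀ r, 0 ≤ mixValue p n m r) (hanti : Antitone (mixValue p n m))
    (hpair : ∀ i j, i < j → j ≤ i + l →
      mixValue p n m i ≤ Real.exp ε * mixValue p n m j + δ) :
    IsDP (ldist l) (secretaryMix n p hp) ε δ := by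
  classical
  intro σ ρ hd S
  have hE : 1 ≤ Real.exp ε := Real.one_le_exp hε
  simp only [selectProb_eq_sum, selectedLaw_eq_mixValue hm hm0 hmn]
  set q := mixValue p n m
  rcases eq_or_swapStep_of_ldist_le_one hd with rfl | hstep
  · have h0 : 0 ≤ ∑ r : Fin n, if σ r ∈ S then q r else 0 :=
      Finset.sum_nonneg fun r _ => by split_ifs; exacts [hnonneg _, le_rfl]
    nlinarith
  · obtain ⟨i, j, hij, hl, rfl⟩ := swapStep_eq hstep
    -- After reindexing, both sums run over the same candidates. Only the one promoted from rank `j`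
    -- to rank `i` can have a positive difference, and that difference is at most `δ`.
    rw [← Equiv.sum_comp (Equiv.swap i j), ← sub_le_iff_le_add', Finset.mul_sum,
      ← Finset.sum_sub_distrib]
    refine (Finset.sum_le_sum (g := fun r => if r = j then δ else 0) fun r _ => ?_).trans
      (by simp)
    simp only [Equiv.Perm.mul_apply, Equiv.swap_apply_self]
    by_cases hS : ρ r ∈ S
    · simp only [hS, if_true]
      by_cases hrj : r = j
      · subst hrj
        simpa [add_comm] using hpair i r hij hl
      · rw [if_neg hrj]
        have hq := hnonneg r
        by_cases hri : r = i
        · subst hri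
          rw [Equiv.swap_apply_left]
          have := hanti (show (r : ℕ) ≤ j from hij.le)
          nlinarith
        · rw [Equiv.swap_apply_of_ne_of_ne hri hrj]
          nlinarith
    · simp only [hS, if_false, mul_zero, sub_zero]
      split_ifs <;> simp [hδ]

/-- Candidate `0` is best in the identity ordering and drops to rank `l` after one allowed swap;
testing privacy on `{0}` gives the bound. -/
lemma mixValue_le_of_isDP {n m : ℕ} [NeZero n] (hm : threshold n = m + 1) (hm0 : 0 < m)
    (hmn : m < n) (p : ℝ≥0) (hp : p ≤ 1) {l : ℕ} (hl : 1 ≤ l) (hln : l < n) {ε δ : ℝ}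
    (h : IsDP (ldist l) (secretaryMix n p hp) ε δ) :
    mixValue p n m 0 ≤ Real.exp ε * mixValue p n m l + δ := by
  classical
  have hstep : SwapStep l (Equiv.swap 0 ⟨l, hln⟩) (1 : Equiv.Perm (Fin n)) :=
    ⟨0, ⟨l, hln⟩, by rw [Fin.lt_def]; exact hl, by simp, by simp [Equiv.swap_comm]⟩
  have := h _ _ (ldist_le_one hstep) {0}
  simp only [selectProb_eq_sum, selectedLaw_eq_mixValue hm hm0 hmn] at this
  simpa [Equiv.swap_apply_eq_iff] using this

end Secretary
end

noncomputable section
namespace Secretary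

open Finset

/-! ### Log-convexity of the selection probabilities -/

lemma weight_succ {n m j : ℕ} (hj : j + 2 < n) :
    weight n m (j + 1) * ((j + 2) * ((n : ℝ) - 2 - j)) =
      weight n m j * ((j + 1) * ((n : ℝ) - m - 1 - j)) := by
  have h : (n : ℝ) - 2 - j ≠ 0 := by
    have : (j : ℝ) + 2 < n := by exact_mod_cast hj
    linarith
  rw [weight, weight, prod_range_succ]
  generalize (∏ i ∈ range j, ((n : ℝ) - m - 1 - i) / ((n : ℝ) - 2 - i)) = Q
  have h1 : (j : ℝ) + 1 ≠ 0 := by positivity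
  have h2 : (j : ℝ) + 1 + 1 ≠ 0 := by positivity
  push_cast
  field_simp
  ring

lemma weight_pos {n m j : ℕ} (hm : 2 ≤ m) (hj : j + m < n) : 0 < weight n m j := by
  have hj' : (j : ℝ) + m < n := by exact_mod_cast hj
  have hm' : (2 : ℝ) ≤ m := by exact_mod_cast hm
  rw [weight]
  refine mul_pos (div_pos (by linarith [j.cast_nonneg (α := ℝ)]) (by positivity))
    (Finset.prod_pos fun i hi => ?_)
  have hi' : (i : ℝ) + 1 ≤ j := by exact_mod_cast mem_range.mp hi
  exact div_pos (by linarith) (by linarith)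

/-- The `n - m` late times cannot hold `j + 1` better ranks; in the product a factor vanishes. -/
lemma weight_eq_zero {n m j : ℕ} (hmn : m ≤ n) (hj : n ≤ j + m) : weight n m j = 0 := by
  rcases hmn.eq_or_lt with rfl | hmn
  · simp [weight]
  · rw [weight, Finset.prod_eq_zero (i := n - m - 1) (by rw [mem_range]; omega), mul_zero]
    rw [Nat.cast_sub (by omega), Nat.cast_sub hmn.le]
    simp

lemma weight_nonneg {n m : ℕ} (hm : 2 ≤ m) (hmn : m ≤ n) (j : ℕ) : 0 ≤ weight n m j := by
  rcases lt_or_ge (j + m) n with h | h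
  · exact (weight_pos hm h).le
  · exact (weight_eq_zero hmn h).ge

lemma weight_zero (n m : ℕ) : weight n m 0 = n - m := by simp [weight]

lemma scaledProb_eq_succ_add {n m r : ℕ} (hm : 2 ≤ m) (hmn : m ≤ n) (hr : 1 ≤ r) :
    scaledProb n m r = scaledProb n m (r + 1) + weight n m r := by
  rw [scaledProb, scaledProb, if_neg (by omega), if_neg (by omega)]
  rcases lt_or_ge r (n - 1) with h | h
  · rw [Finset.sum_eq_sum_Ico_succ_bot h]; ring
  · rw [Finset.Ico_eq_empty (by omega), Finset.Ico_eq_empty (by omega),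
      weight_eq_zero hmn (by omega), add_zero]

lemma scaledProb_zero {n m : ℕ} (hn : 2 ≤ n) :
    scaledProb n m 0 = scaledProb n m 1 + (n - m - 1) := by
  rw [scaledProb, scaledProb, if_pos rfl, if_neg one_ne_zero,
    Finset.sum_eq_sum_Ico_succ_bot (by omega : 0 < n - 1), weight_zero]
  ring

lemma one_le_scaledProb {n m r : ℕ} (hm : 2 ≤ m) (hmn : m ≤ n) (hr : 1 ≤ r) :
    1 ≤ scaledProb n m r := by
  rw [scaledProb, if_neg (by omega)]
  linarith [Finset.sum_nonneg fun j (_ : j ∈ Finset.Ico r (n - 1)) => weight_nonneg hm hmn j]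

lemma antitone_scaledProb {n m : ℕ} (hm : 2 ≤ m) (hmn : m < n) : Antitone (scaledProb n m) := by
  refine antitone_nat_of_succ_le fun r => ?_
  rcases Nat.eq_zero_or_pos r with rfl | hr
  · have : (m : ℝ) + 1 ≤ n := by exact_mod_cast hmn
    rw [scaledProb_zero (by omega)]; linarith
  · rw [scaledProb_eq_succ_add hm hmn.le hr]; linarith [weight_nonneg hm hmn.le r]

/-- The induction step in the log-convex case: the hypotheses say `b / (G + b) ≤ 1 - c / b` and `b /
a ≤ c / b`, so `b / (G + b) ≤ 1 - b / a`. -/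
lemma mul_le_add_mul_sub {a b c G : ℝ} (ha : 0 ≤ a) (hb : 0 < b) (hG : 0 ≤ G)
    (h : b * c ≤ G * (b - c)) (hac : b ^ 2 ≤ a * c) : a * b ≤ (G + b) * (a - b) := by
  have h1 : a * b ^ 2 ≤ (G + b) * (a - b) * b := by
    have h2 : a * b ^ 2 ≤ a * ((G + b) * (b - c)) := by
      apply mul_le_mul_of_nonneg_left _ ha; linarith
    have h3 : (G + b) * b ^ 2 ≤ (G + b) * (a * c) :=
      mul_le_mul_of_nonneg_left hac (by linarith)
    linarith
  exact le_of_mul_le_mul_right (by linarith) hb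

/-- The maximum is attained at `u = 3` and `u = 4`. -/
lemma nat_mul_three_quarters_pow_le (u : ℕ) : (u : ℝ) * (3 / 4) ^ u ≤ 81 / 64 := by
  rcases lt_or_ge u 3 with h | h
  · interval_cases u <;> norm_num
  · induction u, h using Nat.le_induction with
    | base => norm_num
    | succ u hu ih =>
      have hu' : (3 : ℝ) ≤ u := by exact_mod_cast hu
      have : (0 : ℝ) < (3 / 4) ^ u := by positivity
      push_cast
      rw [pow_succ]
      nlinarith

/-- The factor `i = 0` is at most `3 / 4` exactly when `n + 2 ≤ 4 * m`, and later factors are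
smaller still. -/
lemma prod_ratio_le {n m r : ℕ} (hm : 3 ≤ m) (hnm : n + 2 ≤ 4 * m) (hr : r + m < n) :
    ∏ i ∈ range r, ((n : ℝ) - m - 1 - i) / ((n : ℝ) - 2 - i) ≤ (3 / 4) ^ r := by
  have hm' : (3 : ℝ) ≤ m := by exact_mod_cast hm
  have hnm' : (n : ℝ) + 2 ≤ 4 * m := by exact_mod_cast hnm
  have hr' : (r : ℝ) + m < n := by exact_mod_cast hr
  refine (Finset.prod_le_prod (g := fun _ => 3 / 4) (fun i hi => ?_) fun i hi => ?_).trans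
    (by rw [prod_const, card_range])
  all_goals
    have hi' : (i : ℝ) + 1 ≤ r := by exact_mod_cast mem_range.mp hi
    have hi0 : (0 : ℝ) ≤ i := i.cast_nonneg
  · exact div_nonneg (by linarith) (by linarith)
  · rw [div_le_iff₀ (by linarith)]; linarith

lemma weight_mul_le {n m r : ℕ} (hm : 3 ≤ m) (hnm : n + 2 ≤ 4 * m) (hr : r + m < n) :
    weight n m r * ((r + 1) * r) ≤ n - 1 := by
  have hm' : (3 : ℝ) ≤ m := by exact_mod_cast hm
  have hnm' : (n : ℝ) + 2 ≤ 4 * m := by exact_mod_cast hnm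
  have hr' : (r : ℝ) + m < n := by exact_mod_cast hr
  have hprod := prod_ratio_le hm hnm hr
  have h1 : weight n m r * ((r + 1) * r) = (n - m) *
      (r * ∏ i ∈ range r, ((n : ℝ) - m - 1 - i) / ((n : ℝ) - 2 - i)) := by
    rw [weight]
    have : (r : ℝ) + 1 ≠ 0 := by positivity
    field_simp
  rw [h1]
  have hr0 : (0 : ℝ) ≤ r := r.cast_nonneg
  have h2 : r * ∏ i ∈ range r, ((n : ℝ) - m - 1 - i) / ((n : ℝ) - 2 - i) ≤ 81 / 64 :=
    (mul_le_mul_of_nonneg_left hprod hr0).trans (nat_mul_three_quarters_pow_le r)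
  nlinarith

/-- Here `a`, `b`, `c` are three consecutive weights, `h1` and `h2` their recursion, and `h3` the
size bound `weight_mul_le`. -/
lemma sq_le_sub_of_ratio {a b c s d T : ℝ} (ha : 0 < a) (hb : 0 < b) (hs : 2 ≤ s) (hd : 0 < d)
    (hT : 2 ≤ T) (h1 : b * (s * (d + T)) = a * ((s - 1) * d))
    (h2 : c * ((s + 1) * (d + T - 1)) = b * (s * (d - 1)))
    (h3 : b * (s * (s - 1)) ≤ d + T + s - 1) (h : a * c < b ^ 2) : b ^ 2 ≤ a - b := by
  have hdT : 0 < d + T - 1 := by linarith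
  have hpos : 0 < (s - 1) * d * ((s + 1) * (d + T - 1)) := by
    have : 0 < s - 1 := by linarith
    positivity
  -- Failure of log-convexity, expressed through the recursion; expanded, it reads `d * (d + T - 1)
  -- < s ^ 2 * T`.
  have hkey : s ^ 2 * (d - 1) * (d + T) < (s ^ 2 - 1) * d * (d + T - 1) := by
    have h4 := mul_lt_mul_of_pos_right h hpos
    have h5 : a * c * ((s - 1) * d * ((s + 1) * (d + T - 1))) =
        b ^ 2 * (s ^ 2 * (d - 1) * (d + T)) := by
      calc _ = (a * ((s - 1) * d)) * (c * ((s + 1) * (d + T - 1))) := by ring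
        _ = _ := by rw [← h1, h2]; ring
    rw [h5] at h4
    have := lt_of_mul_lt_mul_left h4 (by positivity)
    linarith
  have h6 : b * ((s - 1) * d) ≤ s * T + d := by
    have h7 : d * (b * (s * (s - 1))) ≤ d * (d + T + s - 1) := mul_le_mul_of_nonneg_left h3 hd.le
    have h8 : s * (b * ((s - 1) * d)) ≤ s * (s * T + d) := by linarith
    exact le_of_mul_le_mul_left h8 (by linarith)
  have h9 : a * (b * ((s - 1) * d)) ≤ a * (s * T + d) := mul_le_mul_of_nonneg_left h6 ha.le
  -- By `h1` the right side equals `a * (s * T + d)`.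
  have h10 : b ^ 2 * (s * (d + T)) ≤ (a - b) * (s * (d + T)) := by
    have : b ^ 2 * (s * (d + T)) = b * (a * ((s - 1) * d)) := by rw [← h1]; ring
    linarith
  exact le_of_mul_le_mul_right h10 (by positivity)

/-- Where the ratio of consecutive weights decreases, the weights are small. -/
lemma weight_sq_le_sub {n m r : ℕ} (hm : 3 ≤ m) (hnm : n + 2 ≤ 4 * m) (hr : r + 1 + m < n)
    (h : weight n m r * weight n m (r + 2) < weight n m (r + 1) ^ 2) :
    weight n m (r + 1) ^ 2 ≤ weight n m r - weight n m (r + 1) := by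
  have hm' : (3 : ℝ) ≤ m := by exact_mod_cast hm
  have hr' : (r : ℝ) + 1 + m < n := by exact_mod_cast hr
  have h1 := weight_succ (n := n) (m := m) (j := r) (by omega)
  have h2 := weight_succ (n := n) (m := m) (j := r + 1) (by omega)
  have h3 := weight_mul_le hm hnm hr
  have hapos := weight_pos (j := r) (by omega : 2 ≤ m) (by omega : r + m < n)
  have hbpos := weight_pos (by omega : 2 ≤ m) hr
  rw [show r + 1 + 1 = r + 2 from rfl] at h2
  have hr0 : (0 : ℝ) ≤ r := r.cast_nonneg
  push_cast at h2 h3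
  refine sq_le_sub_of_ratio (s := r + 2) (d := n - m - 1 - r) (T := m - 1) hapos hbpos
    (by linarith) (by linarith) (by linarith) ?_ ?_ ?_ h
  · linear_combination h1
  · linear_combination h2
  · linarith

lemma weight_mul_le_scaledProb_mul {n m : ℕ} (hm : 3 ≤ m) (hmn : m < n) (hnm : n + 2 ≤ 4 * m)
    (r : ℕ) : weight n m r * weight n m (r + 1) ≤
      scaledProb n m (r + 1) * (weight n m r - weight n m (r + 1)) := by
  have hm2 : 2 ≤ m := by omega
  -- Downward induction on `r`, starting where `weight n m (r + 1)` vanishes.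
  induction hd : n - (r + 1 + m) generalizing r with
  | zero =>
    rw [weight_eq_zero (j := r + 1) hmn.le (by omega), mul_zero, sub_zero]
    exact mul_nonneg (zero_le_one.trans (one_le_scaledProb hm2 hmn.le (by omega)))
      (weight_nonneg hm2 hmn.le r)
  | succ d ih =>
    have hF := one_le_scaledProb hm2 hmn.le (show 1 ≤ r + 2 by omega)
    have ha := weight_pos hm2 (show r + m < n by omega)
    have hb := weight_pos hm2 (show r + 1 + m < n by omega)
    rw [scaledProb_eq_succ_add hm2 hmn.le (by omega)]
    by_cases h : weight n m (r + 1) ^ 2 ≤ weight n m r * weight n m (r + 2)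
    · exact mul_le_add_mul_sub ha.le hb (by linarith) (ih (r + 1) (by omega)) h
    -- With `a`, `b` the two weights and `F (r + 2) ≥ 1`, the right side is at least `(1 + b) * (a -
    -- b) = a * b + (a - b - b ^ 2)`.
    · have h' := weight_sq_le_sub hm hnm (by omega) (not_le.mp h)
      nlinarith

lemma scaledProb_one_sq_le {n m : ℕ} (hm : 3 ≤ m) (hmn : m + 2 < n) (hnm : n + 2 ≤ 4 * m)
    (hK : 8 * ((n : ℝ) - 2) ≤ (n - m) * (n + 1)) :
    scaledProb n m 1 ^ 2 ≤ scaledProb n m 0 * scaledProb n m 2 := by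
  have hm2 : 2 ≤ m := by omega
  have hmn' : (m : ℝ) + 3 ≤ n := by exact_mod_cast hmn
  have hm' : (3 : ℝ) ≤ m := by exact_mod_cast hm
  have hB := weight_mul_le_scaledProb_mul hm (by omega : m < n) hnm 1
  have hb := weight_pos hm2 (show 1 + m < n by omega)
  have hF := one_le_scaledProb hm2 (show m ≤ n by omega) (show 1 ≤ 2 by omega)
  have h1 : weight n m 1 = (n - m) * (n - m - 1) / (2 * (n - 2)) := by
    have : (n : ℝ) - 2 ≠ 0 := by linarith
    simp [weight]; field_simp; norm_num; ring
  have h2 : weight n m 2 = (n - m) * (n - m - 1) * (n - m - 2) / (3 * (n - 2) * (n - 3)) := by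
    have h3 : (n : ℝ) - 2 ≠ 0 := by linarith
    have h4 : (n : ℝ) - 3 ≠ 0 := by linarith
    have h5 : (n : ℝ) - 2 - 1 ≠ 0 := by intro h; apply h4; linarith
    simp only [weight, prod_range_succ, range_zero, prod_empty, Nat.cast_zero, Nat.cast_one,
      sub_zero, one_mul, Nat.cast_ofNat]
    field_simp
    ring
  -- The increment `F 0 - F 1 = n - m - 1` plays the role of `w 0`. After clearing denominators this
  -- is precisely `hK`.
  have h3 : weight n m 1 ^ 2 ≤ (n - m - 1) * weight n m 2 := by
    rw [h1, h2, div_pow, ← mul_div_assoc, div_le_div_iff₀ (by nlinarith) (by nlinarith)]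
    have h4 : 0 ≤ ((n : ℝ) - m) * (n - m - 1) ^ 2 * (n - 2) := by
      have : 0 ≤ (n : ℝ) - m := by linarith
      have : 0 ≤ (n : ℝ) - 2 := by linarith
      positivity
    nlinarith [mul_nonneg h4 (sub_nonneg.mpr hK)]
  have h4 := mul_le_add_mul_sub (a := n - m - 1) (by linarith) hb (by linarith) hB h3
  rw [scaledProb_zero (by omega)]
  rw [scaledProb_eq_succ_add hm2 (by omega) le_rfl]
  linarith

/-- The sizes of the sample for which log-convexity is needed. -/
def Admissible (n m : ℕ) : Prop :=
  (n = 7 ∧ m = 2) ∨ (n = 8 ∧ m = 3) ∨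
    (3 ≤ m ∧ m + 2 < n ∧ n + 2 ≤ 4 * m ∧ 8 * ((n : ℝ) - 2) ≤ (n - m) * (n + 1))

lemma Admissible.two_le {n m : ℕ} (h : Admissible n m) : 2 ≤ m := by
  rcases h with h | h | h <;> omega

lemma Admissible.add_two_lt {n m : ℕ} (h : Admissible n m) : m + 2 < n := by
  rcases h with h | h | h <;> omega

lemma sq_le_of_weight_mul_le {n m r : ℕ} (hm : 2 ≤ m) (hmn : m ≤ n)
    (h : weight n m (r + 1) * weight n m (r + 2) ≤
      scaledProb n m (r + 2) * (weight n m (r + 1) - weight n m (r + 2))) :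
    scaledProb n m (r + 2) ^ 2 ≤ scaledProb n m (r + 1) * scaledProb n m (r + 3) := by
  rw [scaledProb_eq_succ_add hm hmn (show 1 ≤ r + 1 by omega)]
  have h2 := scaledProb_eq_succ_add hm hmn (show 1 ≤ r + 2 by omega)
  rw [show scaledProb n m (r + 3) = scaledProb n m (r + 2) - weight n m (r + 2) by linarith,
    show r + 1 + 1 = r + 2 from rfl]
  linarith

/-- The pair `(7, 2)` is outside the range of the general estimates, while `(8, 3)` only violates
the condition needed at `r = 0`; both gaps are closed by computation. -/
lemma Admissible.scaledProb_sq_le {n m : ℕ} (h : Admissible n m) (r : ℕ) :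
    scaledProb n m (r + 1) ^ 2 ≤ scaledProb n m r * scaledProb n m (r + 2) := by
  rcases h with ⟨rfl, rfl⟩ | ⟨rfl, rfl⟩ | ⟨hm, hmn, hnm, hK⟩
  · rcases lt_or_ge r 4 with hr | hr
    · interval_cases r <;>
        norm_num [scaledProb, weight, Finset.sum_Ico_succ_top, prod_range_succ]
    · obtain ⟨k, rfl⟩ : ∃ k, r = k + 1 := ⟨r - 1, by omega⟩
      refine sq_le_of_weight_mul_le (by norm_num) (by norm_num) ?_
      rw [weight_eq_zero (j := k + 2) (by norm_num) (by omega), mul_zero, sub_zero]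
      exact mul_nonneg (zero_le_one.trans (one_le_scaledProb (by norm_num) (by norm_num)
        (by omega))) (weight_nonneg (by norm_num) (by norm_num) _)
  · rcases Nat.eq_zero_or_pos r with rfl | hr
    · norm_num [scaledProb, weight, Finset.sum_Ico_succ_top, prod_range_succ]
    · obtain ⟨k, rfl⟩ : ∃ k, r = k + 1 := ⟨r - 1, by omega⟩
      exact sq_le_of_weight_mul_le (by norm_num) (by norm_num)
        (weight_mul_le_scaledProb_mul (by norm_num) (by norm_num) (by norm_num) _)
  · rcases Nat.eq_zero_or_pos r with rfl | hr
    · exact scaledProb_one_sq_le hm hmn hnm hK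
    · obtain ⟨k, rfl⟩ : ∃ k, r = k + 1 := ⟨r - 1, by omega⟩
      exact sq_le_of_weight_mul_le (by omega) (by omega)
        (weight_mul_le_scaledProb_mul hm (by omega) hnm _)

/-! ### The worst pair of ranks -/

/-- Log-convexity makes the ratios `q (r + 1) / q r` increase, so a drop over `l` ranks is
relatively largest at the top. -/
lemma mul_le_mul_of_logConvex {q : ℕ → ℝ} (hpos : ∀ r, 0 < q r)
    (hq : ∀ r, q (r + 1) ^ 2 ≤ q r * q (r + 2)) (i l : ℕ) :
    q i * q l ≤ q 0 * q (i + l) := by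
  have hratio : Monotone fun r => q (r + 1) / q r := by
    refine monotone_nat_of_le_succ fun r => ?_
    rw [div_le_div_iff₀ (hpos _) (hpos _)]
    nlinarith [hq r]
  induction l with
  | zero => rw [add_zero, mul_comm]
  | succ l ih =>
    have h := hratio (show l ≤ i + l by omega)
    calc q i * q (l + 1) = (q i * q l) * (q (l + 1) / q l) := by
          field_simp [(hpos l).ne']
      _ ≤ (q 0 * q (i + l)) * (q (i + l + 1) / q (i + l)) :=
          mul_le_mul ih h (div_pos (hpos _) (hpos _)).le (mul_pos (hpos _) (hpos _)).le
      _ = q 0 * q (i + (l + 1)) := by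
          field_simp [(hpos (i + l)).ne']; rfl

lemma le_mul_add_of_logConvex {q : ℕ → ℝ} (hpos : ∀ r, 0 < q r) (hanti : Antitone q)
    (hq : ∀ r, q (r + 1) ^ 2 ≤ q r * q (r + 2)) {l : ℕ} {E δ : ℝ} (hE : 0 ≤ E) (hδ : 0 ≤ δ)
    (h : q 0 ≤ E * q l + δ) {i j : ℕ} (hj : j ≤ i + l) : q i ≤ E * q j + δ := by
  have h1 : E * q (i + l) ≤ E * q j := mul_le_mul_of_nonneg_left (hanti hj) hE
  have h2 := mul_le_mul_of_nonneg_left (mul_le_mul_of_logConvex hpos hq i l) hE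
  have h3 : q i ≤ q 0 := hanti (Nat.zero_le i)
  -- Multiply `h` by `q i`, then use `h2` on the first term and `q i ≤ q 0` on the term with `δ`.
  have h4 : q 0 * q i ≤ q 0 * (E * q (i + l) + δ) := by
    nlinarith [hpos i, hpos 0]
  have := le_of_mul_le_mul_left h4 (hpos 0)
  linarith

lemma Admissible.scaledProb_pos {n m : ℕ} (h : Admissible n m) (r : ℕ) :
    0 < scaledProb n m r :=
  (zero_lt_one.trans_le (one_le_scaledProb h.two_le (by linarith [h.add_two_lt])
    (show 1 ≤ r + 1 by omega))).trans_le
    (antitone_scaledProb h.two_le (by linarith [h.add_two_lt]) r.le_succ)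

lemma Admissible.coeff_pos {n m : ℕ} (h : Admissible n m) : 0 < (m : ℝ) / (n * (n - 1)) := by
  have h1 : (2 : ℝ) ≤ m := by exact_mod_cast h.two_le
  have h2 : (m : ℝ) + 2 < n := by exact_mod_cast h.add_two_lt
  exact div_pos (by linarith) (mul_pos (by linarith) (by linarith))

lemma Admissible.mixValue_pos {n m : ℕ} (h : Admissible n m) {p : ℝ} (hp0 : 0 < p) (hp1 : p ≤ 1)
    (r : ℕ) : 0 < mixValue p n m r :=
  add_pos_of_pos_of_nonneg (mul_pos hp0 (mul_pos h.coeff_pos (h.scaledProb_pos r)))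
    (mul_nonneg (by linarith) (by positivity))

lemma Admissible.antitone_mixValue {n m : ℕ} (h : Admissible n m) {p : ℝ} (hp0 : 0 < p) :
    Antitone (mixValue p n m) := by
  intro a b hab
  have hmn := h.add_two_lt
  have := antitone_scaledProb h.two_le (show m < n by omega) hab
  have h2 := h.coeff_pos
  unfold mixValue
  gcongr

/-- Adding a nonnegative constant preserves log-convexity, because a positive log-convex sequence is
convex; this takes care of the blind choice. -/
lemma Admissible.mixValue_sq_le {n m : ℕ} (h : Admissible n m) {p : ℝ} (hp0 : 0 < p)
    (hp1 : p ≤ 1) (r : ℕ) :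
    mixValue p n m (r + 1) ^ 2 ≤ mixValue p n m r * mixValue p n m (r + 2) := by
  have hlc := h.scaledProb_sq_le r
  have h1 := h.scaledProb_pos r
  have h2 := h.scaledProb_pos (r + 1)
  have h3 := h.scaledProb_pos (r + 2)
  have hsum : 2 * scaledProb n m (r + 1) ≤ scaledProb n m r + scaledProb n m (r + 2) := by
    nlinarith [sq_nonneg (scaledProb n m r - scaledProb n m (r + 2))]
  have hA : 0 < p * (m / (n * (n - 1))) := mul_pos hp0 h.coeff_pos
  have hc : 0 ≤ (1 - p) * (1 / (n : ℝ)) := mul_nonneg (by linarith) (by positivity)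
  simp only [mixValue, ← mul_assoc p]
  generalize p * ((m : ℝ) / (n * (n - 1))) = A at *
  generalize (1 - p) * (1 / (n : ℝ)) = c at *
  have h4 := mul_le_mul_of_nonneg_left hlc (sq_nonneg A)
  have h5 := mul_le_mul_of_nonneg_left hsum (mul_nonneg hA.le hc)
  linarith

end Secretary
end

noncomputable section
namespace Secretary

open Finset Filter Topology

/-! ### The threshold -/

lemma log_sub_log_le_sum {t n : ℕ} (ht : 1 ≤ t) (htn : t ≤ n) :
    Real.log n - Real.log t ≤ ∑ i ∈ Finset.Ico t n, (1 : ℝ) / i := by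
  induction n, htn using Nat.le_induction with
  | base => simp
  | succ n hn ih =>
    rw [Finset.sum_Ico_succ_top hn]
    have hn0 : (0 : ℝ) < n := by exact_mod_cast (by omega : 0 < n)
    have h := Real.log_le_sub_one_of_pos (show (0 : ℝ) < (n + 1 : ℕ) / n by positivity)
    rw [Real.log_div (by positivity) hn0.ne'] at h
    have : ((n + 1 : ℕ) : ℝ) / n - 1 = 1 / n := by push_cast; field_simp; ring
    linarith

lemma sum_le_log_sub_log {a b : ℕ} (ha : 1 ≤ a) (hab : a ≤ b) :
    ∑ i ∈ Finset.Ico (a + 1) (b + 1), (1 : ℝ) / i ≤ Real.log b - Real.log a := by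
  induction b, hab using Nat.le_induction with
  | base => simp
  | succ b hb ih =>
    rw [Finset.sum_Ico_succ_top (by omega)]
    have hb0 : (0 : ℝ) < b := by exact_mod_cast (by omega : 0 < b)
    have h := Real.log_le_sub_one_of_pos (show (0 : ℝ) < b / (b + 1 : ℕ) by positivity)
    rw [Real.log_div hb0.ne' (by positivity)] at h
    have : (b : ℝ) / (b + 1 : ℕ) - 1 = -(1 / (b + 1 : ℕ)) := by push_cast; field_simp; ring
    linarith

lemma threshold_eq {n m : ℕ} (h1 : ∑ i ∈ Finset.Ico (m + 1) n, (1 : ℝ) / i ≤ 1)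
    (h2 : 1 < ∑ i ∈ Finset.Ico m n, (1 : ℝ) / i) : threshold n = m + 1 := by
  refine le_antisymm (Nat.sInf_le ⟨by omega, h1⟩) ?_
  refine le_csInf ⟨m + 1, by omega, h1⟩ fun t ht => ?_
  by_contra! hlt
  refine absurd (h2.trans_le ((Finset.sum_le_sum_of_subset_of_nonneg
    (Finset.Ico_subset_Ico_left (show t ≤ m by omega)) fun i _ _ => by positivity).trans ht.2))
    (lt_irrefl _)

lemma exists_threshold_eq {n : ℕ} (hn : 3 ≤ n) :
    ∃ m, 1 ≤ m ∧ m < n ∧ ∑ i ∈ Finset.Ico (m + 1) n, (1 : ℝ) / i ≤ 1 ∧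
      1 < ∑ i ∈ Finset.Ico m n, (1 : ℝ) / i := by
  classical
  have hex : ∃ m, ∑ i ∈ Finset.Ico (m + 1) n, (1 : ℝ) / i ≤ 1 := ⟨n, by simp⟩
  have hone : 1 < ∑ i ∈ Finset.Ico 1 n, (1 : ℝ) / i := by
    refine lt_of_lt_of_le ?_ (Finset.sum_le_sum_of_subset_of_nonneg
      (Finset.Ico_subset_Ico_right hn) fun i _ _ => by positivity)
    norm_num [Finset.sum_Ico_succ_top]
  have h0 : 1 ≤ Nat.find hex := by
    by_contra! h
    have := Nat.find_spec hex
    rw [show Nat.find hex = 0 by omega] at this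
    exact absurd this (not_le.mpr hone)
  have hlt : 1 < ∑ i ∈ Finset.Ico (Nat.find hex) n, (1 : ℝ) / i := by
    have h := Nat.find_min hex (show Nat.find hex - 1 < Nat.find hex by omega)
    rwa [Nat.sub_add_cancel h0, not_le] at h
  refine ⟨Nat.find hex, h0, ?_, Nat.find_spec hex, hlt⟩
  by_contra! h
  rw [Finset.Ico_eq_empty (by omega), sum_empty] at hlt
  exact absurd hlt (by norm_num)

/-- Both harmonic sums are compared with logarithms, which places `m` within a bounded distance of
`n / e`. -/
lemma threshold_bounds {n m : ℕ} (hm : 1 ≤ m) (hmn : m < n)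
    (h1 : ∑ i ∈ Finset.Ico (m + 1) n, (1 : ℝ) / i ≤ 1)
    (h2 : 1 < ∑ i ∈ Finset.Ico m n, (1 : ℝ) / i) :
    (n : ℝ) ≤ Real.exp 1 * (m + 1) ∧ Real.exp 1 * (m - 1) ≤ n - 1 := by
  constructor
  · have h := (log_sub_log_le_sum (by omega) (show m + 1 ≤ n by omega)).trans h1
    have hn : (0 : ℝ) < n := by exact_mod_cast (by omega : 0 < n)
    rw [← Real.log_le_log_iff hn (by positivity), Real.log_mul (by positivity) (by positivity),
      Real.log_exp]
    push_cast at h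
    linarith
  · rcases hm.eq_or_lt with rfl | hm
    · have : (1 : ℝ) ≤ n := by exact_mod_cast (by omega : 1 ≤ n)
      simpa using this
    · obtain ⟨a, rfl⟩ : ∃ a, m = a + 1 := ⟨m - 1, by omega⟩
      obtain ⟨b, rfl⟩ : ∃ b, n = b + 1 := ⟨n - 1, by omega⟩
      have h := (h2.trans_le (sum_le_log_sub_log (by omega) (show a ≤ b by omega))).le
      have ha : (0 : ℝ) < a := by exact_mod_cast (by omega : 0 < a)
      have hb : (0 : ℝ) < b := by exact_mod_cast (by omega : 0 < b)
      push_cast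
      rw [add_sub_cancel_right, add_sub_cancel_right, ← Real.log_le_log_iff (by positivity) hb,
        Real.log_mul (by positivity) (by positivity), Real.log_exp]
      linarith

lemma admissible_of_le {n m : ℕ} (hn : 13 ≤ n) (h1 : (n : ℝ) ≤ Real.exp 1 * (m + 1))
    (h2 : Real.exp 1 * (m - 1) ≤ n - 1) :
    3 ≤ m ∧ m + 2 < n ∧ n + 2 ≤ 4 * m ∧ 8 * ((n : ℝ) - 2) ≤ (n - m) * (n + 1) := by
  have he1 := Real.exp_one_lt_d9
  have he2 := Real.exp_one_gt_d9
  have hn' : (13 : ℝ) ≤ n := by exact_mod_cast hn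
  have hm0 : (0 : ℝ) ≤ m := m.cast_nonneg
  have h3 : (n : ℝ) ≤ 2.719 * (m + 1) := by nlinarith
  have h4 : (n : ℝ) + 1 < 4 * m := by norm_num at h3; linarith
  have h4' : n + 1 < 4 * m := by exact_mod_cast h4
  have h5 : 2.718 * ((m : ℝ) - 1) ≤ n - 1 := by nlinarith
  -- The size `13` is what this estimate needs. By integrality `n - m ≥ 8`, which makes the last
  -- inequality immediate.
  have h6 : (7 : ℝ) < n - m := by norm_num at h5; linarith
  have h6' : m + 7 < n := by
    have : (m : ℝ) + 7 < n := by linarith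
    exact_mod_cast this
  have h7 : (m : ℝ) + 8 ≤ n := by exact_mod_cast h6'
  exact ⟨by omega, by omega, by omega, by nlinarith⟩

lemma exists_admissible {n : ℕ} (hn : 7 ≤ n) : ∃ m, threshold n = m + 1 ∧ Admissible n m := by
  rcases lt_or_ge n 13 with h | h
  · interval_cases n
    · exact ⟨2, threshold_eq (by norm_num [Finset.sum_Ico_succ_top])
        (by norm_num [Finset.sum_Ico_succ_top]), Or.inl ⟨rfl, rfl⟩⟩
    · exact ⟨3, threshold_eq (by norm_num [Finset.sum_Ico_succ_top])
        (by norm_num [Finset.sum_Ico_succ_top]), Or.inr (Or.inl ⟨rfl, rfl⟩)⟩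
    · exact ⟨3, threshold_eq (by norm_num [Finset.sum_Ico_succ_top])
        (by norm_num [Finset.sum_Ico_succ_top]), Or.inr (Or.inr (by norm_num))⟩
    · exact ⟨3, threshold_eq (by norm_num [Finset.sum_Ico_succ_top])
        (by norm_num [Finset.sum_Ico_succ_top]), Or.inr (Or.inr (by norm_num))⟩
    · exact ⟨4, threshold_eq (by norm_num [Finset.sum_Ico_succ_top])
        (by norm_num [Finset.sum_Ico_succ_top]), Or.inr (Or.inr (by norm_num))⟩
    · exact ⟨4, threshold_eq (by norm_num [Finset.sum_Ico_succ_top])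
        (by norm_num [Finset.sum_Ico_succ_top]), Or.inr (Or.inr (by norm_num))⟩
  · obtain ⟨m, hm, hmn, h1, h2⟩ := exists_threshold_eq (show 3 ≤ n by omega)
    obtain ⟨h3, h4⟩ := threshold_bounds hm hmn h1 h2
    exact ⟨m, threshold_eq h1 h2, Or.inr (Or.inr (admissible_of_le h h3 h4))⟩

/-! ### Asymptotics -/

/-- The size of the sample that the optimal algorithm rejects. -/
def sampleSize (n : ℕ) : ℕ := threshold n - 1

lemma sampleSize_bounds {n : ℕ} (hn : 3 ≤ n) :
    (n : ℝ) ≤ Real.exp 1 * (sampleSize n + 1) ∧ Real.exp 1 * (sampleSize n - 1) ≤ n - 1 := by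
  obtain ⟨m, hm, hmn, h1, h2⟩ := exists_threshold_eq hn
  rw [show sampleSize n = m by rw [sampleSize, threshold_eq h1 h2, Nat.add_sub_cancel]]
  exact threshold_bounds hm hmn h1 h2

lemma tendsto_sampleSize_div :
    Tendsto (fun n : ℕ => (sampleSize n : ℝ) / n) atTop (𝓝 (1 / Real.exp 1)) := by
  have h1 : Tendsto (fun n : ℕ => (1 : ℝ) / n) atTop (𝓝 0) := tendsto_one_div_atTop_nhds_zero_nat
  have he : 0 < Real.exp 1 := Real.exp_pos 1
  refine tendsto_of_tendsto_of_tendsto_of_le_of_le'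
    (g := fun n : ℕ => 1 / Real.exp 1 - 1 / (n : ℝ))
    (h := fun n : ℕ => 1 / Real.exp 1 + 1 / (n : ℝ))
    (by simpa using h1.const_sub (1 / Real.exp 1)) (by simpa using h1.const_add (1 / Real.exp 1))
    ?_ ?_
  · filter_upwards [eventually_ge_atTop 3] with n hn
    have hn0 : (0 : ℝ) < n := by exact_mod_cast (by omega : 0 < n)
    have h := (sampleSize_bounds hn).1
    rw [div_sub_div _ _ he.ne' hn0.ne', div_le_div_iff₀ (by positivity) hn0]
    nlinarith
  · filter_upwards [eventually_ge_atTop 3] with n hn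
    have hn0 : (0 : ℝ) < n := by exact_mod_cast (by omega : 0 < n)
    have h := (sampleSize_bounds hn).2
    rw [div_add_div _ _ he.ne' hn0.ne', div_le_div_iff₀ hn0 (by positivity)]
    nlinarith

lemma tendsto_ratio (a b : ℝ) :
    Tendsto (fun n : ℕ => ((n : ℝ) - sampleSize n - a) / (n - b)) atTop
      (𝓝 (1 - 1 / Real.exp 1)) := by
  have h1 : ∀ c : ℝ, Tendsto (fun n : ℕ => c / (n : ℝ)) atTop (𝓝 0) :=
    tendsto_const_div_atTop_nhds_zero_nat
  have h2 : Tendsto (fun n : ℕ => (1 - (sampleSize n : ℝ) / n - a / n) / (1 - b / n)) atTop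
      (𝓝 ((1 - 1 / Real.exp 1 - 0) / (1 - 0))) :=
    ((tendsto_sampleSize_div.const_sub 1).sub (h1 a)).div ((h1 b).const_sub 1) (by norm_num)
  rw [sub_zero, sub_zero, div_one] at h2
  refine h2.congr' ?_
  filter_upwards [eventually_gt_atTop 0] with n hn
  have hn0 : (n : ℝ) ≠ 0 := by exact_mod_cast hn.ne'
  rw [← mul_div_mul_right _ (1 - b / n) hn0]
  congr 1 <;> field_simp

lemma tendsto_coeff_mul_weight (j : ℕ) :
    Tendsto (fun n : ℕ => (sampleSize n : ℝ) / (n * (n - 1)) * weight n (sampleSize n) j) atTop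
      (𝓝 (1 / Real.exp 1 * (1 / ((j + 1 : ℕ) : ℝ) * (1 - 1 / Real.exp 1) ^ (j + 1)))) := by
  have hprod : Tendsto (fun n : ℕ => ∏ i ∈ range j,
      ((n : ℝ) - sampleSize n - 1 - i) / ((n : ℝ) - 2 - i)) atTop
      (𝓝 (∏ _i ∈ range j, (1 - 1 / Real.exp 1))) :=
    tendsto_finsetProd _ fun i _ => (tendsto_ratio (1 + i) (2 + i)).congr fun n => by
      rw [← sub_sub, ← sub_sub]
  have h := (tendsto_sampleSize_div.mul
    (((tendsto_ratio 0 1).mul_const (1 / ((j + 1 : ℕ) : ℝ))).mul hprod))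
  rw [prod_const, card_range] at h
  convert h using 2
  · rw [weight]
    push_cast
    simp only [div_eq_mul_inv, mul_inv, sub_zero, one_mul]
    ring
  · ring

/-- A geometric majorant independent of `n`, for dominated convergence. -/
lemma coeff_mul_weight_le {n m : ℕ} (hm : 3 ≤ m) (hmn : m + 2 < n) (hnm : n + 2 ≤ 4 * m) (j : ℕ) :
    ‖(m : ℝ) / (n * (n - 1)) * weight n m j‖ ≤ (3 / 4) ^ j := by
  have hm' : (3 : ℝ) ≤ m := by exact_mod_cast hm
  have hmn' : (m : ℝ) + 2 < n := by exact_mod_cast hmn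
  have hw := weight_nonneg (show 2 ≤ m by omega) (show m ≤ n by omega) j
  have hc : 0 ≤ (m : ℝ) / (n * (n - 1)) :=
    div_nonneg (by linarith) (mul_nonneg (by linarith) (by linarith))
  rw [Real.norm_of_nonneg (mul_nonneg hc hw)]
  rcases lt_or_ge (j + m) n with h | h
  · have hprod := prod_ratio_le hm hnm h
    have h1 : (m : ℝ) / (n * (n - 1)) * (((n : ℝ) - m) / (j + 1)) ≤ 1 := by
      have hj : (0 : ℝ) ≤ j := j.cast_nonneg
      rw [div_mul_div_comm, div_le_one (by
        have : 0 < (n : ℝ) * (n - 1) := mul_pos (by linarith) (by linarith)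
        positivity)]
      have : (m : ℝ) * (n - m) ≤ n * (n - 1) := by nlinarith
      have h0 : 0 ≤ (n : ℝ) * (n - 1) := mul_nonneg (by linarith) (by linarith)
      nlinarith
    rw [weight, ← mul_assoc]
    refine (mul_le_mul_of_nonneg_left hprod (mul_nonneg hc
      (div_nonneg (by linarith) (by positivity)))).trans ?_
    exact mul_le_of_le_one_left (by positivity) h1
  · rw [weight_eq_zero (by omega) h, mul_zero]; positivity

lemma sum_Ico_weight_eq_tsum {n m : ℕ} (hm : 1 ≤ m) (hmn : m ≤ n) (r : ℕ) :
    ∑ j ∈ Finset.Ico r (n - 1), weight n m j = ∑' j, weight n m (r + j) := by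
  rw [Finset.sum_Ico_eq_sum_range, tsum_eq_sum]
  intro j hj
  rw [mem_range] at hj
  exact weight_eq_zero hmn (by omega)

lemma tendsto_coeff_mul_sum (r : ℕ) :
    Tendsto (fun n : ℕ => (sampleSize n : ℝ) / (n * (n - 1)) *
      ∑ j ∈ Finset.Ico r (n - 1), weight n (sampleSize n) j) atTop
      (𝓝 (1 / Real.exp 1 * tailSum (r + 1))) := by
  have h : Tendsto (fun n : ℕ => ∑' j, (sampleSize n : ℝ) / (n * (n - 1)) *
      weight n (sampleSize n) (r + j)) atTop
      (𝓝 (∑' j, 1 / Real.exp 1 * (1 / ((r + j + 1 : ℕ) : ℝ) *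
        (1 - 1 / Real.exp 1) ^ (r + j + 1)))) := by
    refine tendsto_tsum_of_dominated_convergence (bound := fun j : ℕ => (3 / 4 : ℝ) ^ j)
      (summable_geometric_of_lt_one (by norm_num) (by norm_num))
      (fun j => tendsto_coeff_mul_weight (r + j)) ?_
    filter_upwards [eventually_ge_atTop 13] with n hn j
    obtain ⟨h1, h2⟩ := sampleSize_bounds (show 3 ≤ n by omega)
    obtain ⟨h3, h4, h5, -⟩ := admissible_of_le hn h1 h2
    exact (coeff_mul_weight_le h3 h4 h5 (r + j)).trans
      (pow_le_pow_of_le_one (by norm_num) (by norm_num) (by omega))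
  rw [tsum_mul_left] at h
  have htail : tailSum (r + 1) = ∑' j : ℕ, (1 / ((r + j + 1 : ℕ) : ℝ) *
      (1 - 1 / Real.exp 1) ^ (r + j + 1)) := by
    rw [tailSum]
    exact tsum_congr fun j => by rw [show r + 1 + j = r + j + 1 by ring]
  rw [htail]
  refine h.congr' ?_
  filter_upwards [eventually_ge_atTop 13] with n hn
  obtain ⟨h1, h2⟩ := sampleSize_bounds (show 3 ≤ n by omega)
  obtain ⟨h3, h4, -, -⟩ := admissible_of_le hn h1 h2
  rw [tsum_mul_left, sum_Ico_weight_eq_tsum (by omega) (by omega)]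

/-- The fall-through summand `1` carries a factor of order `1 / n`, and the blind choice contributes
`(1 - p) / n`; both vanish in the limit. -/
lemma tendsto_mixValue (p : ℝ) (r : ℕ) :
    Tendsto (fun n : ℕ => mixValue p n (sampleSize n) r) atTop
      (𝓝 (p / Real.exp 1 * tailSum (r + 1))) := by
  have h1 : Tendsto (fun n : ℕ => (1 : ℝ) / n) atTop (𝓝 0) := tendsto_one_div_atTop_nhds_zero_nat
  have h2 : Tendsto (fun n : ℕ => (1 : ℝ) / (n - 1)) atTop (𝓝 0) :=
    tendsto_const_nhds.div_atTop
      (tendsto_atTop_add_const_right _ _ tendsto_natCast_atTop_atTop)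
  have h3 := (tendsto_sampleSize_div.mul h2).mul_const (if r = 0 then (0 : ℝ) else 1)
  have h4 := ((h3.add (tendsto_coeff_mul_sum r)).const_mul p).add (h1.const_mul (1 - p))
  convert h4 using 2
  · rw [mixValue, scaledProb, div_mul_div_comm, mul_one, ← mul_add]
  · ring

lemma summable_tailSum (k : ℕ) : Summable fun i : ℕ =>
    1 / ((k + 1 + i : ℕ) : ℝ) * (1 - 1 / Real.exp 1) ^ (k + 1 + i) := by
  have h1 : 0 ≤ 1 - 1 / Real.exp 1 := by
    rw [sub_nonneg, div_le_one (Real.exp_pos 1)]; exact Real.one_le_exp zero_le_one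
  have h2 : 1 - 1 / Real.exp 1 < 1 := by linarith [div_pos one_pos (Real.exp_pos 1)]
  refine Summable.of_nonneg_of_le (fun i => by positivity) (fun i => ?_)
    (summable_geometric_of_lt_one h1 h2)
  refine (mul_le_of_le_one_left (by positivity) ?_).trans
    (pow_le_pow_of_le_one h1 h2.le (by omega))
  rw [div_le_one (by positivity)]
  exact_mod_cast (by omega : 1 ≤ k + 1 + i)

lemma tailSum_pos (k : ℕ) : 0 < tailSum (k + 1) := by
  have h1 : 0 < 1 - 1 / Real.exp 1 := by
    rw [sub_pos, div_lt_one (Real.exp_pos 1)]; exact Real.one_lt_exp_iff.mpr one_pos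
  exact (summable_tailSum k).tsum_pos (fun i => by positivity) 0 (by positivity)

/-- This is the series of `-log (1 - x)` at `x = 1 - 1 / e`. -/
lemma tailSum_one : tailSum 1 = 1 := by
  have h2 : 1 - 1 / Real.exp 1 < 1 := by linarith [div_pos one_pos (Real.exp_pos 1)]
  have h1 : 0 ≤ 1 - 1 / Real.exp 1 := by
    rw [sub_nonneg, div_le_one (Real.exp_pos 1)]; exact Real.one_le_exp zero_le_one
  have h := Real.hasSum_pow_div_log_of_abs_lt_one (x := 1 - 1 / Real.exp 1)
    (by rw [abs_of_nonneg h1]; exact h2)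
  rw [sub_sub_cancel, one_div, Real.log_inv, Real.log_exp, neg_neg] at h
  rw [tailSum]
  refine (tsum_congr fun i => ?_).trans h.tsum_eq
  rw [add_comm 1 i]
  push_cast
  rw [one_div_mul_eq_div, one_div]

end Secretary
end

/-! ### ### The privacy criterion, the limit and the theorem -/

noncomputable section
namespace Secretary

open Filter Topology

lemma eventually_mixProb_eq (p : ℝ≥0) (hp : p ≤ 1) (σ : (n : ℕ) → Equiv.Perm (Fin (n + 1)))
    (k : ℕ) : ∀ᶠ n : ℕ in atTop,
      mixValue p (n + 1) (sampleSize (n + 1)) k = mixProb p hp (σ n) (k + 1) := by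
  filter_upwards [eventually_ge_atTop (max 7 k)] with n hn
  obtain ⟨h7, hk⟩ := max_le_iff.mp hn
  obtain ⟨m, hm, hA⟩ := exists_admissible (show 7 ≤ n + 1 by omega)
  have h1 := hA.two_le
  have h2 := hA.add_two_lt
  rw [mixProb_eq_mixValue hm (by omega) (by omega) p hp (σ n) (by omega : k < n + 1),
    sampleSize, hm, Nat.add_sub_cancel]

lemma tendsto_mixProb (p : ℝ≥0) (hp : p ≤ 1) (σ : (n : ℕ) → Equiv.Perm (Fin (n + 1))) (k : ℕ) :
    Tendsto (fun n => mixProb p hp (σ n) (k + 1)) atTop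
      (𝓝 (p / Real.exp 1 * tailSum (k + 1))) :=
  ((tendsto_mixValue p k).comp (tendsto_add_atTop_nat 1)).congr' (eventually_mixProb_eq p hp σ k)

lemma Admissible.isDP_iff {n m : ℕ} [NeZero n] (h : Admissible n m) (hm : threshold n = m + 1)
    {p : ℝ≥0} (hp0 : 0 < p) (hp : p ≤ 1) {l : ℕ} (hl : 1 ≤ l) (hln : l < n) {ε δ : ℝ}
    (hε : 0 ≤ ε) (hδ : 0 ≤ δ) :
    IsDP (ldist l) (secretaryMix n p hp) ε δ ↔
      mixValue p n m 0 ≤ Real.exp ε * mixValue p n m l + δ := by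
  have h1 := h.two_le
  have h2 := h.add_two_lt
  have hp0' : (0 : ℝ) < p := by exact_mod_cast hp0
  have hp' : (p : ℝ) ≤ 1 := by exact_mod_cast hp
  refine ⟨mixValue_le_of_isDP hm (by omega) (by omega) p hp hl hln, fun hle => ?_⟩
  exact isDP_of_mixValue hm (by omega) (by omega) p hp hε hδ
    (fun r => (h.mixValue_pos hp0' hp' r).le) (h.antitone_mixValue hp0') fun i j _ hj =>
      le_mul_add_of_logConvex (h.mixValue_pos hp0' hp') (h.antitone_mixValue hp0')
        (h.mixValue_sq_le hp0' hp') (Real.exp_pos ε).le hδ hle hj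

lemma log_div_le_iff_le_exp_mul_add {a b δ ε : ℝ} (hb : 0 < b) (hab : δ < a) :
    Real.log ((a - δ) / b) ≤ ε ↔ a ≤ Real.exp ε * b + δ := by
  rw [Real.log_le_iff_le_exp (div_pos (by linarith) hb), div_le_iff₀ hb, sub_le_iff_le_add]

end Secretary
end

open Secretary in
theorem theorem4 (l : ℕ) (hl : 1 ≤ l) (p : ℝ≥0) (hp0 : 0 < p) (hp1 : p ≤ 1)
    (δ : ℝ) (hδ0 : 0 ≤ δ) (hδ1 : δ ≤ 1) :
    -- privacy and tightness, for every `n ≥ 7` and every fixed `σ`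
    (∀ (n : ℕ) [NeZero n], 7 ≤ n → l ≤ n - 1 → ∀ σ : Equiv.Perm (Fin n),
      (δ < mixProb p hp1 σ 1 - mixProb p hp1 σ (l + 1) → ∀ ε : ℝ,
        (IsDP (ldist l) (secretaryMix n p hp1) ε δ ↔
          Real.log ((mixProb p hp1 σ 1 - δ) / mixProb p hp1 σ (l + 1)) ≤ ε)) ∧
      (mixProb p hp1 σ 1 - mixProb p hp1 σ (l + 1) ≤ δ → ∀ ε : ℝ, 0 ≤ ε →
        IsDP (ldist l) (secretaryMix n p hp1) ε δ) ∧
      IsLeast {ε : ℝ | 0 ≤ ε ∧ IsDP (ldist l) (secretaryMix n p hp1) ε δ}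
        (if δ < mixProb p hp1 σ 1 - mixProb p hp1 σ (l + 1) then
          Real.log ((mixProb p hp1 σ 1 - δ) / mixProb p hp1 σ (l + 1)) else 0)) ∧
    -- asymptotics of the bound (with `n + 1` candidates, `n → ∞`)
    (δ < p / Real.exp 1 → ∀ σ : (n : ℕ) → Equiv.Perm (Fin (n + 1)),
      Filter.Tendsto
        (fun n => Real.log ((mixProb p hp1 (σ n) 1 - δ) / mixProb p hp1 (σ n) (l + 1)))
        Filter.atTop
        (nhds (Real.log ((p - δ * Real.exp 1) / (tailSum (l + 1) * p)))) ∧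
      (δ ≠ p / Real.exp 1 * (1 - tailSum (l + 1)) →
        Filter.Tendsto
          (fun n => Real.log ((mixProb p hp1 (σ n) 1 - δ) / mixProb p hp1 (σ n) (l + 1)) /
            Real.log ((p - δ * Real.exp 1) / (tailSum (l + 1) * p)))
          Filter.atTop (nhds 1))) := by
  refine ⟨?_, ?_⟩
  · intro n _ hn hln σ
    obtain ⟨m, hm, hA⟩ := exists_admissible hn
    have h1 := hA.two_le
    have h2 := hA.add_two_lt
    have hp0' : (0 : ℝ) < p := by exact_mod_cast hp0
    have hp1' : (p : ℝ) ≤ 1 := by exact_mod_cast hp1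
    have hln' : l < n := by omega
    have hb := hA.mixValue_pos hp0' hp1' l
    have hq0 : mixProb p hp1 σ 1 = mixValue p n m 0 :=
      mixProb_eq_mixValue hm (by omega) (by omega) p hp1 σ (k := 0) (by omega)
    rw [hq0, mixProb_eq_mixValue hm (by omega) (by omega) p hp1 σ hln']
    have hfirst : δ < mixValue p n m 0 - mixValue p n m l →
        0 < Real.log ((mixValue p n m 0 - δ) / mixValue p n m l) ∧
        ∀ ε : ℝ, (IsDP (ldist l) (secretaryMix n p hp1) ε δ ↔
          Real.log ((mixValue p n m 0 - δ) / mixValue p n m l) ≤ ε) := by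
      intro hδ
      have hlog : 0 < Real.log ((mixValue p n m 0 - δ) / mixValue p n m l) :=
        Real.log_pos ((one_lt_div hb).mpr (by linarith))
      refine ⟨hlog, fun ε => ?_⟩
      rw [log_div_le_iff_le_exp_mul_add hb (by linarith)]
      refine ⟨mixValue_le_of_isDP hm (by omega) (by omega) p hp1 hl hln', fun h => ?_⟩
      -- The sufficiency argument needs `0 ≤ ε`; here this follows from the inequality itself, since
      -- the logarithm is positive.
      have hε := hlog.trans_le ((log_div_le_iff_le_exp_mul_add hb (by linarith)).mpr h)
      exact (hA.isDP_iff hm hp0 hp1 hl hln' hε.le hδ0).mpr h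
    have hsecond : mixValue p n m 0 - mixValue p n m l ≤ δ → ∀ ε : ℝ, 0 ≤ ε →
        IsDP (ldist l) (secretaryMix n p hp1) ε δ := by
      intro hδ ε hε
      refine (hA.isDP_iff hm hp0 hp1 hl hln' hε hδ0).mpr ?_
      nlinarith [Real.one_le_exp hε]
    refine ⟨fun hδ => (hfirst hδ).2, hsecond, ?_⟩
    split_ifs with hδ
    · obtain ⟨hlog, hiff⟩ := hfirst hδ
      exact ⟨⟨hlog.le, (hiff _).mpr le_rfl⟩, fun ε hε => (hiff ε).mp hε.2⟩
    · exact ⟨⟨le_rfl, hsecond (not_lt.mp hδ) 0 le_rfl⟩, fun ε hε => hε.1⟩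
  · intro hδ σ
    have he : 0 < Real.exp 1 := Real.exp_pos 1
    have hp : (0 : ℝ) < p := by exact_mod_cast hp0
    have ha := tailSum_pos l
    have hnum : 0 < p - δ * Real.exp 1 := by
      rw [lt_div_iff₀ he] at hδ; linarith
    have h0 := tendsto_mixProb p hp1 σ 0
    -- Because `a_1 = 1`, the best candidate is selected with limiting probability `p / e`, so `δ <
    -- p / e` keeps the limiting numerator positive.
    rw [zero_add, tailSum_one, mul_one] at h0
    have hratio := (h0.sub_const δ).div (tendsto_mixProb p hp1 σ l) (by positivity)
    have heq : ((p : ℝ) / Real.exp 1 - δ) / (p / Real.exp 1 * tailSum (l + 1)) =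
        (p - δ * Real.exp 1) / (tailSum (l + 1) * p) := by
      field_simp
    rw [heq] at hratio
    have hlim := hratio.log (div_pos hnum (by positivity)).ne'
    refine ⟨hlim, fun hne => ?_⟩
    have hL : Real.log ((p - δ * Real.exp 1) / (tailSum (l + 1) * p)) ≠ 0 := by
      refine Real.log_ne_zero_of_pos_of_ne_one (div_pos hnum (by positivity)) fun h => hne ?_
      rw [div_eq_one_iff_eq (by positivity)] at h
      field_simp
      linarith
    have hdiv := hlim.div_const (Real.log ((p - δ * Real.exp 1) / (tailSum (l + 1) * p)))
    rwa [div_self hL] at hdiv
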